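/- Let $\mathbb{F}$ be a field, let $n\ge 0$ be an integer and let $A$ be an $n\times n$ matrix over $\mathbb{F}$. For $S,T\subseteq[n]=\{1,\dots,n\}$ write $A[S,T]$ for the submatrix of $A$ with rows indexed by $S$ and columns indexed by $T$, write $A[S]=A[S,S]$, and let $\overline{S}=[n]\setminus S$. Suppose that $A$ satisfies property $\mathcal{R}$, that is: (1) $A$ is dense: all off-diagonal entries of $A$ are nonzero; (2) $A$ has the rank-one extension property: for any four distinct indices $i,j,k,\ell\in[n]$ with $\operatorname{rank} A[\{i,j\},\{k,\ell\}]=1$, there exists a subset $S\subseteq[n]$ with $i,j\in S$ and $k,\ell\in\overline{S}$ such that $\operatorname{rank} A[S,\overline{S}]=1$. Let $B$ be an $n\times n$ matrix over $\mathbb{F}$ such that $A$ and $B$ have equal corresponding principal minors of order at most $4$, that is, $\det A[S]=\det B[S]$ for every $S\subseteq[n]$ with $|S|\le 4$. Then $A$ and $B$ have equal corresponding principal minors of all orders: $\det A[S]=\det B[S]$ for every $S\subseteq[n]$. -/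

import Mathlib

namespace PrincipalMinors

/-- `A[S, T]`: the submatrix of `A` with rows indexed by `S` and columns indexed by `T`. -/
def sub {F : Type*} {n : ℕ} (A : Matrix (Fin n) (Fin n) F) (S T : Finset (Fin n)) :
    Matrix S T F :=
  A.submatrix Subtype.val Subtype.val

/-- The principal minor `det A[S]`, where `A[S] = A[S, S]`. -/
def principalMinor {F : Type*} [Field F] {n : ℕ} (A : Matrix (Fin n) (Fin n) F)
    (S : Finset (Fin n)) : F :=
  (sub A S S).det

/-- A matrix is dense if all its off-diagonal entries are nonzero. -/
def Dense {F : Type*} [Field F] {n : ℕ} (A : Matrix (Fin n) (Fin n) F) : Prop :=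
  ∀ i j : Fin n, i ≠ j → A i j ≠ 0

/-- The rank-one extension property: whenever `i, j, k, l` are four distinct indices such that
`A[{i, j}, {k, l}]` has rank one, there is a set `S` of indices with `i, j ∈ S` and `k, l ∉ S`
such that `A[S, Sᶜ]` has rank one. -/
def RankOneExtension {F : Type*} [Field F] {n : ℕ} (A : Matrix (Fin n) (Fin n) F) : Prop :=
  ∀ i j k l : Fin n, i ≠ j → i ≠ k → i ≠ l → j ≠ k → j ≠ l → k ≠ l →
    (sub A {i, j} {k, l}).rank = 1 →
      ∃ S : Finset (Fin n), i ∈ S ∧ j ∈ S ∧ k ∈ Sᶜ ∧ l ∈ Sᶜ ∧ (sub A S Sᶜ).rank = 1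

/-- Property `R`: dense, with the rank-one extension property. -/
def PropertyR {F : Type*} [Field F] {n : ℕ} (A : Matrix (Fin n) (Fin n) F) : Prop :=
  Dense A ∧ RankOneExtension A

/-- `A` and `B` have equal corresponding principal minors of order at most `k`. -/
def PMEUpTo {F : Type*} [Field F] {n : ℕ} (k : ℕ) (A B : Matrix (Fin n) (Fin n) F) : Prop :=
  ∀ S : Finset (Fin n), S.card ≤ k → principalMinor A S = principalMinor B S

/-- `A` and `B` are principal minor equivalent: they have equal corresponding principal minors
of all orders. -/
def PME {F : Type*} [Field F] {n : ℕ} (A B : Matrix (Fin n) (Fin n) F) : Prop :=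
  ∀ S : Finset (Fin n), principalMinor A S = principalMinor B S

end PrincipalMinors

/-! Minors of order at most 3 fix the diagonal, the products `a i j * a j i`, and for each triangle
the unordered pair of weights of its two orientations. So `b` treats a triangle of `a` in one of
three ways, recorded by `triSign`: symmetric, kept or reversed. If no triangle in `W` is reversed,
`b` is diagonally similar to `a` on `W`; if none is kept, to the transpose of `a`. In both cases
(`Coherent`) the minors on `W` agree.

Otherwise `a` has a cut: `MinorData.coherent_or_hasCut` shows that every `W` is coherent or splits
into two sides of size at least two with both off-diagonal blocks of rank one. To see this,
normalise the entries at a base index `m`. Pairs of other indices become edges coloured by `triSign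
a b m`, order-4 minors constrain triangles with two different nonzero colours, and rank-one
extension becomes a rule about equal entries. A monochromatic component that misses a suitable
vertex produces a cut (`IsColored.baseCut_of_closed`). Inductively, a cut of `W` minus a point
extends to that point, except when its two blocks extend to opposite sides; this star configuration
is settled by `IsStar.baseCut_or_mono`.

Finally, across a cut the minor is a function of minors on proper subsets (`minor_union_formula`),
so induction suffices whenever `b` shares the cut. For a cut with a smallest possible side `S`, `b`
can fail to share it only if `S` is a pair; then `MinorData.minor_eq_of_twins` passes from `a` to
`b` through an intermediate matrix having one cut in common with each. -/

namespace PrincipalMinors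

/-! ### Coloured graphs seen from a base index, and cuts from monochromatic components. -/

section ColoredBase

variable {V K : Type*}

/-- The combinatorial data seen from a base index `m`: `E j k` is the normalised off-diagonal
entry and `g j k` records whether the triangle `m, j, k` is symmetric (`0`), preserved (`1`) or
reversed (`-1`). -/
structure IsColored (U : Finset V) (E : V → V → K) (g : V → V → SignType) : Prop where
  symm : ∀ j k, g j k = g k j
  diag : ∀ j, g j j = 0
  zero : ∀ j ∈ U, ∀ k ∈ U, j ≠ k → (g j k = 0 ↔ E j k = E k j)
  -- The common end of the two equally coloured edges sees their other ends alike. In particular, if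
  -- exactly one edge of a triangle has colour 0, the other two have the same colour.
  tri : ∀ j ∈ U, ∀ k ∈ U, ∀ l ∈ U, g j k ≠ 0 → g j l ≠ 0 → g j k ≠ g j l →
    (g k l = g j k ∧ E k j = E k l ∧ E j k = E l k) ∨
    (g k l = g j l ∧ E l j = E l k ∧ E j l = E k l)
  -- Rank-one extension for the rows of the base index and `s` and the columns `j, k`: the fifth
  -- index `v` can replace `k` or `s`.
  row : ∀ s ∈ U, ∀ j ∈ U, ∀ k ∈ U, ∀ v ∈ U, s ≠ j → s ≠ k → s ≠ v → j ≠ k → j ≠ v → k ≠ v →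
    E s j = E s k → E s v = E s j ∨ E v j = E v k
  col : ∀ s ∈ U, ∀ j ∈ U, ∀ k ∈ U, ∀ v ∈ U, s ≠ j → s ≠ k → s ≠ v → j ≠ k → j ≠ v → k ≠ v →
    E j s = E k s → E v s = E j s ∨ E j v = E k v

/-- A two-sided rank-one cut with the base index on the side complementary to `D`. -/
def BaseCut (U : Finset V) (E : V → V → K) : Prop :=
  ∃ D ⊆ U, (∃ x ∈ D, ∃ y ∈ D, x ≠ y) ∧ (∃ w ∈ U, w ∉ D) ∧
    ∀ u ∈ U, u ∉ D → ∀ x ∈ D, ∀ y ∈ D, E u x = E u y ∧ E x u = E y u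

theorem IsColored.transpose {U : Finset V} {E : V → V → K} {g : V → V → SignType}
    (h : IsColored U E g) : IsColored U (fun i j => E j i) g where
  symm := h.symm
  diag := h.diag
  zero j hj k hk hjk := by rw [h.zero j hj k hk hjk, eq_comm]
  tri j hj k hk l hl h1 h2 h3 := by
    have := h.tri j hj k hk l hl h1 h2 h3
    tauto
  row s hs j hj k hk v hv := h.col s hs j hj k hk v hv
  col s hs j hj k hk v hv := h.row s hs j hj k hk v hv

theorem BaseCut.transpose {U : Finset V} {E : V → V → K} (h : BaseCut U (fun i j => E j i)) :
    BaseCut U E := by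
  obtain ⟨D, h1, h2, h3, h4⟩ := h
  exact ⟨D, h1, h2, h3, fun u hu hu' x hx y hy => (h4 u hu hu' x hx y hy).symm⟩

/-- `P` serves only to keep `w` out of the `ε`-component `C` of `t`. By `tri` along `ε`-edges, an
outside vertex with nonzero colour towards `C` sees all of `C` alike. One with colour 0 may still
separate points of `C`; adding all such vertices gives `D`, and `row` and `col` make the remaining
vertices see `D` alike. The vertex `w` is not added because its colour towards `t` is nonzero. -/
theorem IsColored.baseCut_of_closed {U : Finset V} {E : V → V → K} {g : V → V → SignType}
    (h : IsColored U E g) {ε : SignType} (hε : ε ≠ 0) {t s w : V} {P : V → Prop}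
    (ht : t ∈ U) (hs : s ∈ U) (hw : w ∈ U) (hts : g t s = ε) (htw : g t w ≠ 0)
    (hPt : P t) (hPw : ¬ P w) (hP : ∀ v ∈ U, ∀ u ∈ U, P v → g v u = ε → P u) :
    BaseCut U E := by
  classical
  let R : V → V → Prop := fun a b => b ∈ U ∧ g a b = ε
  let C : V → Prop := Relation.ReflTransGen R t
  have hCt : C t := Relation.ReflTransGen.refl
  have hCs : C s := Relation.ReflTransGen.single ⟨hs, hts⟩
  have hCU : ∀ x, C x → x ∈ U ∧ P x := by
    intro x hx
    induction hx with
    | refl => exact ⟨ht, hPt⟩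
    | tail _ hbc ih => exact ⟨hbc.1, hP _ ih.1 _ hbc.1 ih.2 hbc.2⟩
  have hCw : ¬ C w := fun hc => hPw (hCU w hc).2
  have hne : t ≠ s := by rintro rfl; exact hε (hts ▸ h.diag t)
  have hstep : ∀ x, C x → ∀ y ∈ U, g x y = ε → C y :=
    fun x hx y hy hxy => Relation.ReflTransGen.tail hx ⟨hy, hxy⟩
  -- vertices outside the component see it homogeneously
  have hom : ∀ u ∈ U, ¬ C u → ∀ x, C x →
      (g u t ≠ 0 → g u x ≠ 0 ∧ E u x = E u t ∧ E x u = E t u) ∧ (g u t = 0 → g u x = 0) := by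
    intro u hu huC x hx
    induction hx with
    | refl => simp
    | @tail b c hb hbc ih =>
      have hbU := (hCU b hb).1
      have h1 : g b u ≠ ε := fun hh => huC (hstep b hb u hu hh)
      have h2 : g c u ≠ ε := fun hh => huC (hstep c (hstep b hb c hbc.1 hbc.2) u hu hh)
      have h3 := hbc.2
      have h4 := h.symm b c
      have h5 := h.symm b u
      have h6 := h.symm c u
      have h7 := h.tri b hbU c hbc.1 u hu
      have h8 := h.tri c hbc.1 b hbU u hu
      grind
  let D : V → Prop := fun v => v ∈ U ∧ (C v ∨ ∃ x y, C x ∧ C y ∧ E v x ≠ E v y)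
  -- Colour 0 means symmetric entries and nonzero colour means constant ones, so outgoing
  -- information about `C` transfers to incoming entries.
  have hD0 : ∀ v ∈ U, ¬ C v → (∀ x, C x → E v x = E v t) → ∀ x, C x → E x v = E t v := by
    intro v hv hvC hc x hx
    rcases eq_or_ne (g v t) 0 with h0 | h0
    · have e1 := (h.zero v hv x (hCU x hx).1 (by rintro rfl; exact hvC hx)).1
        ((hom v hv hvC x hx).2 h0)
      have e2 := (h.zero v hv t ht (by rintro rfl; exact hvC hCt)).1 h0
      rw [← e1, ← e2, hc x hx]
    · exact ((hom v hv hvC x hx).1 h0).2.2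
  have hD1 : ∀ v ∈ U, ¬ C v → (∃ x y, C x ∧ C y ∧ E v x ≠ E v y) →
      ∃ x y, C x ∧ C y ∧ E v x ≠ E v y ∧ E x v ≠ E y v := by
    rintro v hv hvC ⟨x, y, hx, hy, hxy⟩
    rcases eq_or_ne (g v t) 0 with h0 | h0
    · have e1 := (h.zero v hv x (hCU x hx).1 (by rintro rfl; exact hvC hx)).1
        ((hom v hv hvC x hx).2 h0)
      have e2 := (h.zero v hv y (hCU y hy).1 (by rintro rfl; exact hvC hy)).1
        ((hom v hv hvC y hy).2 h0)
      exact ⟨x, y, hx, hy, hxy, by rw [← e1, ← e2]; exact hxy⟩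
    · have := ((hom v hv hvC x hx).1 h0).2.1
      have := ((hom v hv hvC y hy).1 h0).2.1
      grind
  have main : ∀ u ∈ U, ¬ D u → ∀ x, D x → E u x = E u t ∧ E x u = E t u := by
    intro u hu huD
    have huC : ¬ C u := fun hc => huD ⟨hu, Or.inl hc⟩
    have hconst : ∀ x, C x → E u x = E u t := by
      intro x hx
      by_contra hh
      exact huD ⟨hu, Or.inr ⟨x, t, hx, hCt, hh⟩⟩
    have hconst' := hD0 u hu huC hconst
    rintro x ⟨hxU, hx⟩
    by_cases hxC : C x
    · exact ⟨hconst x hxC, hconst' x hxC⟩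
    · obtain ⟨y, z, hy, hz, h1, h2⟩ := hD1 x hxU hxC (hx.resolve_left hxC)
      have hyU := (hCU y hy).1
      have hzU := (hCU z hz).1
      have n1 : u ≠ y := by rintro rfl; exact huC hy
      have n2 : u ≠ z := by rintro rfl; exact huC hz
      have n3 : u ≠ x := by rintro rfl; exact huD ⟨hxU, hx⟩
      have n4 : y ≠ z := by rintro rfl; exact h1 rfl
      have n5 : y ≠ x := by rintro rfl; exact hxC hy
      have n6 : z ≠ x := by rintro rfl; exact hxC hz
      -- Since `x` separates `y` from `z` and `u` does not, only the alternative in which `u` sees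
      -- `x` as it sees `y` survives.
      have r1 := h.row u hu y hyU z hzU x hxU n1 n2 n3 n4 n5 n6
      have r2 := h.col u hu y hyU z hzU x hxU n1 n2 n3 n4 n5 n6
      have := hconst y hy
      have := hconst z hz
      have := hconst' y hy
      have := hconst' z hz
      grind
  have hwD : ¬ D w := by
    rintro ⟨-, hw' | ⟨x, y, hx, hy, hxy⟩⟩
    · exact hCw hw'
    · rw [h.symm] at htw
      have := ((hom w hw hCw x hx).1 htw).2.1
      have := ((hom w hw hCw y hy).1 htw).2.1
      grind
  refine ⟨U.filter D, Finset.filter_subset _ _, ⟨t, ?_, s, ?_, hne⟩, ⟨w, hw, ?_⟩, ?_⟩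
  · exact Finset.mem_filter.2 ⟨ht, ht, Or.inl hCt⟩
  · exact Finset.mem_filter.2 ⟨hs, hs, Or.inl hCs⟩
  · exact fun hh => hwD (Finset.mem_filter.1 hh).2
  · intro u hu huD x hx y hy
    have huD' : ¬ D u := fun hh => huD (Finset.mem_filter.2 ⟨hu, hh⟩)
    have a := main u hu huD' x (Finset.mem_filter.1 hx).2
    have b := main u hu huD' y (Finset.mem_filter.1 hy).2
    exact ⟨a.1.trans b.1.symm, a.2.trans b.2.symm⟩

end ColoredBase

end PrincipalMinors

namespace PrincipalMinors

/-! ### The star configuration: a cut whose two blocks absorb the base index on opposite sides. -/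

section Star

variable {V K : Type*}

/-- The configuration in which the two one-sided extensions of a cut `S | Y` by the base index
go to different sides. -/
structure IsStar (U : Finset V) (E : V → V → K) (S Y : V → Prop) (α β : V → K) : Prop where
  mem : ∀ v, v ∈ U ↔ S v ∨ Y v
  disj : ∀ v, S v → ¬ Y v
  out : ∀ s t, S s → Y t → E s t = α s
  back : ∀ s t, S s → Y t → E t s = β t

theorem IsStar.swap {U : Finset V} {E : V → V → K} {S Y : V → Prop} {α β : V → K}
    (h : IsStar U E S Y α β) : IsStar U E Y S β α where
  mem v := by rw [h.mem, or_comm]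
  disj v hy hs := h.disj v hs hy
  out s t hs ht := h.back t s ht hs
  back s t hs ht := h.out t s ht hs

variable {U : Finset V} {E : V → V → K} {g : V → V → SignType} {S Y : V → Prop} {α β : V → K}

theorem IsStar.zero_iff (hs : IsStar U E S Y α β) (h : IsColored U E g) {s t : V}
    (h1 : S s) (h2 : Y t) : g s t = 0 ↔ α s = β t := by
  rw [h.zero s ((hs.mem s).2 (Or.inl h1)) t ((hs.mem t).2 (Or.inr h2))
    (by rintro rfl; exact hs.disj _ h1 h2), hs.out s t h1 h2, hs.back s t h1 h2]

/-- `tri` at `t` decides which of the two edges `s s'` copies; `col` with fifth index `t'` then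
gives the value of `E t t'`, because `β` separates `t` from `t'`. -/
theorem IsStar.bicoloured (hs : IsStar U E S Y α β) (h : IsColored U E g) {s s' t t' : V}
    (h1 : S s) (h2 : S s') (h3 : Y t) (h4 : Y t') (hβ : β t' ≠ β t)
    (c1 : g s t ≠ 0) (c2 : g s' t ≠ 0) (c3 : g s t ≠ g s' t) :
    (g s s' = g s' t ∧ E s s' = β t ∧ E s' s = α s' ∧ E t t' = α s) ∨
    (g s s' = g s t ∧ E s' s = β t ∧ E s s' = α s ∧ E t t' = α s') := by
  have u1 := (hs.mem s).2 (Or.inl h1)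
  have u2 := (hs.mem s').2 (Or.inl h2)
  have u3 := (hs.mem t).2 (Or.inr h3)
  have u4 := (hs.mem t').2 (Or.inr h4)
  have d1 : s ≠ s' := by rintro rfl; exact c3 rfl
  have d2 : s ≠ t := by rintro rfl; exact hs.disj _ h1 h3
  have d3 : s' ≠ t := by rintro rfl; exact hs.disj _ h2 h3
  have d4 : s ≠ t' := by rintro rfl; exact hs.disj _ h1 h4
  have d5 : s' ≠ t' := by rintro rfl; exact hs.disj _ h2 h4
  have d6 : t ≠ t' := by rintro rfl; exact hβ rfl
  have e1 := h.symm s t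
  have e2 := h.symm s' t
  have e3 := h.symm s s'
  have T := h.tri t u3 s u1 s' u2
  have R1 := h.col s' u2 t u3 s u1 t' u4 d3 d1.symm d5 d2.symm d6 d4
  have R2 := h.col s u1 t u3 s' u2 t' u4 d2 d1 d4 d3.symm d6 d5
  have := hs.out s t h1 h3
  have := hs.out s' t h2 h3
  have := hs.out s t' h1 h4
  have := hs.out s' t' h2 h4
  have := hs.back s t h1 h3
  have := hs.back s' t h2 h3
  have := hs.back s t' h1 h4
  have := hs.back s' t' h2 h4
  grind

/-- Apply `baseCut_of_closed` to the `ε`-component of `t`, with `s'` as the vertex left out. The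
invariant is that `s'` sees each member as it sees `t`: along an edge of colour `η`, with outgoing
entry `α s'` and incoming entry `β t`. In `Y` this amounts to `β v = β t`, by `A0`. -/
theorem IsStar.baseCut_of_bicoloured_aux (hs : IsStar U E S Y α β) (h : IsColored U E g)
    {ε η : SignType} (hε : ε ≠ 0) (hη : η ≠ 0) (hεη : ε ≠ η) {s s' t t₀ : V}
    (h1 : S s) (h2 : S s') (h3 : Y t) (h4 : Y t₀) (hβ : β t₀ ≠ β t) (hα : α s ≠ α s')
    (c1 : g s t = ε) (c2 : g s' t = η) (c3 : g s s' = η) (e1 : E s s' = β t) :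
    BaseCut U E := by
  have hc : ∀ a b, g a b = 0 ∨ g a b = ε ∨ g a b = η := by
    intro a b
    have key : ∀ ε η c : SignType, ε ≠ 0 → η ≠ 0 → ε ≠ η → c = 0 ∨ c = ε ∨ c = η := by decide
    exact key ε η _ hε hη hεη
  have US : ∀ v, S v → v ∈ U := fun v hv => (hs.mem v).2 (Or.inl hv)
  have UY : ∀ v, Y v → v ∈ U := fun v hv => (hs.mem v).2 (Or.inr hv)
  have Z : ∀ a b, S a → Y b → (g a b = 0 ↔ α a = β b) := fun a b ha hb => hs.zero_iff h ha hb
  have sy := h.symm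
  -- row of `t`
  have A1 : ∀ t', Y t' → β t' ≠ β t → E t t' = α s := by
    intro t' ht' hb
    have := hs.bicoloured h h1 h2 h3 ht' hb (by grind) (by grind) (by grind)
    grind
  have nz' : ∀ t', Y t' → β t' = β t → g s' t' ≠ 0 ∧ g s t' ≠ 0 := by
    intro t' ht' hb
    have := Z s' t h2 h3
    have := Z s t h1 h3
    have := Z s' t' h2 ht'
    have := Z s t' h1 ht'
    grind
  have A0 : ∀ t', Y t' → β t' = β t → g s' t' = η := by
    intro t' ht' hb
    have n := nz' t' ht' hb
    have T := h.tri s' (US _ h2) s (US _ h1) t' (UY _ ht')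
    have := hs.out s t' h1 ht'
    have := hs.back s' t' h2 ht'
    have := hs.out s' t' h2 ht'
    have := hs.back s t' h1 ht'
    have := sy s' s
    have := sy s t'
    have := hc s' t'
    have z1 := Z s t h1 h3
    grind
  have A2 : ∀ t', Y t' → β t' ≠ β t → g s' t' ≠ ε := by
    intro t' ht' hb hg
    have := hs.swap.bicoloured h h3 ht' h2 h1 hα (by grind) (by grind) (by grind)
    have := A1 t' ht' hb
    have := Z s t h1 h3
    grind
  have A3 : ∀ t₁ t', Y t₁ → Y t' → β t₁ = β t → β t' ≠ β t → g t₁ t' ≠ ε := by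
    intro t₁ t' ht₁ ht' hb₁ hb hg
    have a0 := A0 t₁ ht₁ hb₁
    have a2 := A2 t' ht' hb
    have T := h.tri t₁ (UY _ ht₁) s' (US _ h2) t' (UY _ ht')
    have := sy t₁ s'
    have := hs.back s' t₁ h2 ht₁
    have := hs.back s' t' h2 ht'
    grind
  have A4 : ∀ t₁ x, Y t₁ → S x → β t₁ = β t → α x ≠ α s → g x t₁ ≠ ε := by
    have key : ∀ t₁ x, Y t₁ → S x → β t₁ = β t → α x ≠ α s → g s t₁ = ε → g x t₁ ≠ ε := by
      intro t₁ x ht₁ hx hb ha hst hg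
      have a0 := A0 t₁ ht₁ hb
      have b1 := hs.bicoloured h h1 h2 ht₁ h4 (hb ▸ hβ) (by grind) (by grind) (by grind)
      have b2 := hs.bicoloured h hx h2 ht₁ h4 (hb ▸ hβ) (by grind) (by grind) (by grind)
      grind
    intro t₁ x ht₁ hx hb ha hg
    have hst : g s t₁ = η := by
      have := key t₁ x ht₁ hx hb ha
      have := nz' t₁ ht₁ hb
      have := hc s t₁
      grind
    have a0 := A0 t₁ ht₁ hb
    have b1 := hs.bicoloured h h1 hx ht₁ h4 (hb ▸ hβ) (by grind) (by grind) (by grind)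
    have b2 := hs.bicoloured h h2 hx ht₁ h4 (hb ▸ hβ) (by grind) (by grind) (by grind)
    have k := key t x h3 hx rfl ha c1
    have T := h.tri s (US _ h1) t (UY _ h3) x (US _ hx)
    have := hs.out s t h1 h3
    have := hs.back x t hx h3
    have := hs.out x t hx h3
    have := hs.back s t h1 h3
    have := sy t x
    have := Z s t h1 h3
    grind
  have A5 : ∀ t₁ w, Y t₁ → S w → β t₁ = β t → g t₁ w = ε →
      g s' w = η ∧ α w ≠ α s' ∧ E w s' = β t ∧ E s' w = α s' := by
    intro t₁ w ht₁ hw hb hg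
    have hg' : g w t₁ = ε := by rw [sy]; exact hg
    have a0 := A0 t₁ ht₁ hb
    have aw : α w = α s := by
      by_contra hh
      exact A4 t₁ w ht₁ hw hb hh hg'
    have b1 := hs.bicoloured h hw h2 ht₁ h4 (hb ▸ hβ) (by grind) (by grind) (by grind)
    rcases b1 with b1 | b1
    · have := sy s' w
      grind
    · exfalso
      -- the edge `w s'` has the colour of `w t₁`
      have zt : g w t ≠ 0 := by
        have := Z w t hw h3
        have := Z s t h1 h3
        grind
      rcases hc w t with hwt | hwt | hwt
      · exact zt hwt
      · have b2 := hs.bicoloured h hw h2 h3 h4 hβ (by grind) (by grind) (by grind)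
        have := A1 t₀ h4 hβ
        grind
      · have T := h.tri s' (US _ h2) w (US _ hw) t (UY _ h3)
        have := hs.out w t hw h3
        have := hs.out s' t h2 h3
        have := hs.back w t hw h3
        have := hs.back s' t h2 h3
        have := sy s' w
        grind
  have A6 : ∀ v w, S v → S w → g s' v = η → α v ≠ α s' → E v s' = β t → E s' v = α s' →
      g v w = ε → g s' w = η ∧ α w ≠ α s' ∧ E w s' = β t ∧ E s' w = α s' := by
    intro v w hv hw p1 p2 p3 p4 hg
    have ne : ∀ a b, g a b ≠ 0 → a ≠ b := by
      rintro a b hab rfl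
      exact hab (h.diag a)
    have n1 := ne v w (by grind)
    have wt_of : α w = α s' → False := by
      intro aw
      have z := Z w t hw h3
      have z' := Z s' t h2 h3
      have n := A4 t w h3 hw rfl (by grind)
      have hwt : g w t = η := by have := hc w t; grind
      have T := h.tri w (US _ hw) v (US _ hv) t (UY _ h3)
      have := hs.out w t hw h3
      have := hs.out v t hv h3
      have := hs.back w t hw h3
      have := hs.back v t hv h3
      have := sy w v
      have hvt : g v t = ε ∨ g v t = η := by have := hc v t; grind
      rcases hvt with hvt | hvt
      · have b := hs.bicoloured h hv hw h3 h4 hβ (by grind) (by grind) (by grind)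
        have := A1 t₀ h4 hβ
        grind
      · grind
    have T := h.tri v (US _ hv) s' (US _ h2) w (US _ hw)
    have hsv := sy v s'
    rcases hc s' w with q | q | q
    · grind
    · exfalso
      have T2 := h.tri s' (US _ h2) w (US _ hw) t (UY _ h3)
      have o1 := hs.out w t hw h3
      have o2 := hs.out s' t h2 h3
      have o3 := hs.back w t hw h3
      have o4 := hs.back s' t h2 h3
      rcases hc w t with hwt | hwt | hwt
      · grind
      · have b := hs.bicoloured h hw h2 h3 h4 hβ (by grind) (by grind) (by grind)
        have := A1 t₀ h4 hβ
        have := sy s' w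
        grind
      · have : α w = α s' := by grind
        exact wt_of this
    · refine ⟨q, fun hh => wt_of hh, ?_⟩
      grind
  refine h.baseCut_of_closed hε (t := t) (s := s) (w := s')
    (P := fun v => (Y v ∧ β v = β t) ∨
      (S v ∧ g s' v = η ∧ α v ≠ α s' ∧ E v s' = β t ∧ E s' v = α s'))
    (UY _ h3) (US _ h1) (US _ h2) (by rw [sy]; exact c1) (by rw [sy, c2]; exact hη)
    (Or.inl ⟨h3, rfl⟩) ?_ ?_
  · rintro (⟨q, -⟩ | ⟨-, q, -⟩)
    · exact hs.disj _ h2 q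
    · exact hη (q ▸ h.diag s')
  · intro v hv u hu hPv hg
    have hv' := (hs.mem v).1 hv
    rcases (hs.mem u).1 hu with su | yu
    · right
      rcases hPv with ⟨yv, bv⟩ | ⟨sv, p1, p2, p3, p4⟩
      · exact ⟨su, A5 v u yv su bv hg⟩
      · exact ⟨su, A6 v u sv su p1 p2 p3 p4 hg⟩
    · left
      refine ⟨yu, ?_⟩
      by_contra hb
      rcases hPv with ⟨yv, bv⟩ | ⟨sv, p1, p2, p3, p4⟩
      · exact A3 v u yv yu bv hb hg
      · have a2 := A2 u yu hb
        have T := h.tri v hv s' (US _ h2) u hu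
        have := hc s' u
        have := sy v s'
        have := hs.back v u sv yu
        have := hs.back s' u h2 yu
        have := hs.out v u sv yu
        have := hs.out s' u h2 yu
        grind

theorem IsStar.baseCut_of_bicoloured (hs : IsStar U E S Y α β) (h : IsColored U E g)
    {s s' t t₀ : V} (h1 : S s) (h2 : S s') (h3 : Y t) (h4 : Y t₀) (hβ : β t₀ ≠ β t)
    (hα : α s ≠ α s') (c1 : g s t ≠ 0) (c2 : g s' t ≠ 0) (c3 : g s t ≠ g s' t) :
    BaseCut U E := by
  rcases hs.bicoloured h h1 h2 h3 h4 hβ c1 c2 c3 with b | b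
  · exact hs.baseCut_of_bicoloured_aux h c1 c2 c3 h1 h2 h3 h4 hβ hα rfl rfl b.1 b.2.1
  · exact hs.baseCut_of_bicoloured_aux h c2 c1 c3.symm h2 h1 h3 h4 hβ hα.symm rfl rfl
      (by rw [h.symm]; exact b.1) b.2.1

theorem IsStar.eq_of_alpha_ne (hs : IsStar U E S Y α β) (h : IsColored U E g)
    (hcut : ¬ BaseCut U E) (hβ : ∃ t, Y t ∧ ∃ t', Y t' ∧ β t ≠ β t') {s s' t : V}
    (h1 : S s) (h2 : S s') (h3 : Y t) (c1 : g s t ≠ 0) (c2 : g s' t ≠ 0) (hα : α s ≠ α s') :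
    g s t = g s' t := by
  by_contra c3
  obtain ⟨t₁, y1, t₂, y2, hb⟩ := hβ
  by_cases hq : β t₁ = β t
  · exact hcut (hs.baseCut_of_bicoloured h h1 h2 h3 y2 (fun e => hb (hq.trans e.symm)) hα c1 c2 c3)
  · exact hcut (hs.baseCut_of_bicoloured h h1 h2 h3 y1 hq hα c1 c2 c3)

/-- A vertex `s₀` with another `α` cannot be joined to `t` in a nonzero colour, since it would agree
with both `s₁` and `s₂`; so `α s₀ = β t`, and a similar argument gives `α s₁ = β t'`. Then `s t`, `s
s₀`, `s₀ t'` is a path of nonzero edges for `s = s₁, s₂`, while `s₀ t` and `s t'` have colour 0.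
Hence the path is monochromatic, and both edges have the colour of `s₀ t'`. -/
theorem IsStar.eq_of_alpha_eq_aux (hs : IsStar U E S Y α β) (h : IsColored U E g)
    (hcut : ¬ BaseCut U E) {s₁ s₂ s₀ t t' : V} (h1 : S s₁) (h2 : S s₂) (h0 : S s₀) (h3 : Y t)
    (h4 : Y t') (hα : α s₁ = α s₂) (hα' : α s₀ ≠ α s₁) (hβ : β t' ≠ β t)
    (c1 : g s₁ t ≠ 0) (c2 : g s₂ t ≠ 0) : g s₁ t = g s₂ t := by
  by_contra c3
  have sy := h.symm
  have US : ∀ v, S v → v ∈ U := fun v hv => (hs.mem v).2 (Or.inl hv)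
  have UY : ∀ v, Y v → v ∈ U := fun v hv => (hs.mem v).2 (Or.inr hv)
  have Z : ∀ a b, S a → Y b → (g a b = 0 ↔ α a = β b) := fun a b ha hb => hs.zero_iff h ha hb
  have hαex : ∃ s, S s ∧ ∃ s', S s' ∧ α s ≠ α s' := ⟨s₀, h0, s₁, h1, hα'⟩
  have hβex : ∃ t, Y t ∧ ∃ t', Y t' ∧ β t ≠ β t' := ⟨t', h4, t, h3, hβ⟩
  have D1 : ∀ a a' b, S a → S a' → Y b → g a b ≠ 0 → g a' b ≠ 0 → α a ≠ α a' →
    g a b = g a' b := fun a a' b ha ha' hb => hs.eq_of_alpha_ne h hcut hβex ha ha' hb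
  have D2 : ∀ a b b', S a → Y b → Y b' → g b a ≠ 0 → g b' a ≠ 0 → β b ≠ β b' →
    g b a = g b' a := fun a b b' ha hb hb' => hs.swap.eq_of_alpha_ne h hcut hαex hb hb' ha
  have z0 : g s₀ t = 0 := by
    by_contra hz
    have := D1 s₀ s₁ t h0 h1 h3 hz c1 hα'
    have := D1 s₀ s₂ t h0 h2 h3 hz c2 (by grind)
    grind
  have e0 : α s₀ = β t := (Z s₀ t h0 h3).1 z0
  have k0 : g s₀ t' ≠ 0 := by
    have := Z s₀ t' h0 h4
    grind
  have e1 : α s₁ = β t' := by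
    by_contra hne
    have n1 : g s₁ t' ≠ 0 := fun hz => hne ((Z s₁ t' h1 h4).1 hz)
    have n2 : g s₂ t' ≠ 0 := fun hz => hne (hα.trans ((Z s₂ t' h2 h4).1 hz))
    have := D1 s₀ s₁ t' h0 h1 h4 k0 n1 hα'
    have := D1 s₀ s₂ t' h0 h2 h4 k0 n2 (by grind)
    have := D2 s₁ t t' h1 h3 h4 (by grind) (by grind) (Ne.symm hβ)
    have := D2 s₂ t t' h2 h3 h4 (by grind) (by grind) (Ne.symm hβ)
    have := sy t s₁
    have := sy t s₂
    have := sy t' s₁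
    have := sy t' s₂
    grind
  have et : E t t' = α s₁ := by
    rcases hs.bicoloured h h1 h2 h3 h4 hβ c1 c2 c3 with b | b
    · exact b.2.2.2
    · exact b.2.2.2.trans hα.symm
  have fin : ∀ s, S s → α s = α s₁ → g s t ≠ 0 → g s t = g s₀ t' := by
    intro s hS ha hst
    have d1 : s ≠ s₀ := by rintro rfl; exact hα' ha
    have d2 : s ≠ t := by rintro rfl; exact hs.disj _ hS h3
    have d3 : s ≠ t' := by rintro rfl; exact hs.disj _ hS h4
    have d4 : s₀ ≠ t := by rintro rfl; exact hs.disj _ h0 h3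
    have d5 : s₀ ≠ t' := by rintro rfl; exact hs.disj _ h0 h4
    have d6 : t ≠ t' := by rintro rfl; exact hβ rfl
    have o1 := hs.out s t hS h3
    have o2 := hs.out s t' hS h4
    have o3 := hs.out s₀ t h0 h3
    have o4 := hs.out s₀ t' h0 h4
    have b1 := hs.back s t hS h3
    have b2 := hs.back s t' hS h4
    have b3 := hs.back s₀ t h0 h3
    have b4 := hs.back s₀ t' h0 h4
    have R1 := h.col t' (UY _ h4) t (UY _ h3) s (US _ hS) s₀ (US _ h0) d6.symm d3.symm d5.symm
      d2.symm d4.symm d1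
    have E1 : E s s₀ = β t := by grind
    have R2 := h.col s (US _ hS) t (UY _ h3) s₀ (US _ h0) t' (UY _ h4) d2 d1 d3 d4.symm d6 d5
    have E2 : E s₀ s ≠ β t := by grind
    have n : g s s₀ ≠ 0 := by
      have := h.zero s (US _ hS) s₀ (US _ h0) d1
      grind
    have T1 := h.tri s (US _ hS) s₀ (US _ h0) t (UY _ h3)
    have T2 := h.tri s₀ (US _ h0) s (US _ hS) t' (UY _ h4)
    have z1 := Z s t' hS h4
    have := sy s s₀
    grind
  have f1 := fin s₁ h1 rfl c1
  have f2 := fin s₂ h2 hα.symm c2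
  exact c3 (f1.trans f2.symm)

/-- Away from a base cut, the edges from `t ∈ Y` to `S` all have the same colour. -/
theorem IsStar.bip_eq (hs : IsStar U E S Y α β) (h : IsColored U E g)
    (hcut : ¬ BaseCut U E) (hα : ∃ s, S s ∧ ∃ s', S s' ∧ α s ≠ α s')
    (hβ : ∃ t, Y t ∧ ∃ t', Y t' ∧ β t ≠ β t') {s s' t : V}
    (h1 : S s) (h2 : S s') (h3 : Y t) (c1 : g s t ≠ 0) (c2 : g s' t ≠ 0) :
    g s t = g s' t := by
  by_cases ha : α s = α s'
  · obtain ⟨s₀, h0, hne⟩ : ∃ s₀, S s₀ ∧ α s₀ ≠ α s := by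
      obtain ⟨a, ha, b, hb, hab⟩ := hα
      by_cases hq : α a = α s
      · exact ⟨b, hb, fun e => hab (hq.trans e.symm)⟩
      · exact ⟨a, ha, hq⟩
    obtain ⟨t₀, h4, hne'⟩ : ∃ t₀, Y t₀ ∧ β t₀ ≠ β t := by
      obtain ⟨a, ha, b, hb, hab⟩ := hβ
      by_cases hq : β a = β t
      · exact ⟨b, hb, fun e => hab (hq.trans e.symm)⟩
      · exact ⟨a, ha, hq⟩
    exact hs.eq_of_alpha_eq_aux h hcut h1 h2 h0 h3 h4 ha hne hne' c1 c2
  · exact hs.eq_of_alpha_ne h hcut hβ h1 h2 h3 c1 c2 ha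

theorem IsStar.exists_ne_zero (hs : IsStar U E S Y α β) (h : IsColored U E g)
    (hβ : ∃ t, Y t ∧ ∃ t', Y t' ∧ β t ≠ β t') {s : V} (h1 : S s) : ∃ t, Y t ∧ g s t ≠ 0 := by
  obtain ⟨a, ha, b, hb, hab⟩ := hβ
  have z1 := hs.zero_iff h h1 ha
  have z2 := hs.zero_iff h h1 hb
  by_cases hq : g s a = 0
  · exact ⟨b, hb, by grind⟩
  · exact ⟨a, ha, hq⟩

/-- Edges from `s` to `Y` share one colour by `bip_eq`, so a deviating `v` lies in `S`. The
component of `s` in the deviating colour stays among vertices of `S` whose colour towards `Y` is `g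
s t`, so it never reaches `t`, and a base cut follows. -/
theorem IsStar.mono_left (hs : IsStar U E S Y α β) (h : IsColored U E g)
    (hcut : ¬ BaseCut U E) (hα : ∃ s, S s ∧ ∃ s', S s' ∧ α s ≠ α s')
    (hβ : ∃ t, Y t ∧ ∃ t', Y t' ∧ β t ≠ β t') {s t v : V} (h1 : S s) (h3 : Y t)
    (c1 : g s t ≠ 0) (hv : v ∈ U) (c2 : g s v ≠ 0) : g s v = g s t := by
  have sy := h.symm
  have US : ∀ v, S v → v ∈ U := fun v hv => (hs.mem v).2 (Or.inl hv)
  have UY : ∀ v, Y v → v ∈ U := fun v hv => (hs.mem v).2 (Or.inr hv)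
  have B1 : ∀ a a' b, S a → S a' → Y b → g a b ≠ 0 → g a' b ≠ 0 → g a b = g a' b :=
    fun a a' b ha ha' hb => hs.bip_eq h hcut hα hβ ha ha' hb
  have B2 : ∀ a b b', S a → Y b → Y b' → g a b ≠ 0 → g a b' ≠ 0 → g a b = g a b' := by
    intro a b b' ha hb hb' n n'
    rw [sy a b] at n ⊢
    rw [sy a b'] at n' ⊢
    exact hs.swap.bip_eq h hcut hβ hα hb hb' ha n n'
  by_contra hne
  have hSv : S v := by
    rcases (hs.mem v).1 hv with q | q
    · exact q
    · exact absurd (B2 s v t h1 q h3 c2 c1) hne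
  -- edges inside `S` join vertices with the same colour towards `Y`
  have same : ∀ a a' b, S a → S a' → Y b → g a a' ≠ 0 → g a b ≠ 0 →
      ∃ b', Y b' ∧ g a' b' ≠ 0 ∧ g a' b' = g a b := by
    intro a a' b ha ha' hb n n'
    by_cases hz : g a' b = 0
    · obtain ⟨b', hb', n''⟩ := hs.exists_ne_zero h hβ ha'
      refine ⟨b', hb', n'', ?_⟩
      have T1 := h.tri a (US _ ha) a' (US _ ha') b (UY _ hb)
      have T2 := h.tri a' (US _ ha') a (US _ ha) b' (UY _ hb')
      have := sy a a'
      have := B2 a b b' ha hb hb'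
      grind
    · exact ⟨b, hb, hz, (B1 a a' b ha ha' hb n' hz).symm⟩
  refine hcut (h.baseCut_of_closed c2 (t := s) (s := v) (w := t)
    (P := fun x => S x ∧ ∃ b, Y b ∧ g x b ≠ 0 ∧ g x b = g s t) (US _ h1) hv (UY _ h3) rfl c1
    ⟨h1, t, h3, c1, rfl⟩ (fun q => hs.disj _ q.1 h3) ?_)
  rintro x hx u hu ⟨hSx, b, hb, n1, n2⟩ hxu
  have hSu : S u := by
    rcases (hs.mem u).1 hu with q | q
    · exact q
    · have := B2 x u b hSx q hb (by grind) n1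
      grind
  obtain ⟨b', hb', n1', n2'⟩ := same x u b hSx hSu hb (by grind) n1
  exact ⟨hSu, b', hb', n1', n2'.trans n2⟩

theorem IsStar.baseCut_or_mono (hs : IsStar U E S Y α β) (h : IsColored U E g)
    (hα : ∃ s, S s ∧ ∃ s', S s' ∧ α s ≠ α s') (hβ : ∃ t, Y t ∧ ∃ t', Y t' ∧ β t ≠ β t') :
    BaseCut U E ∨ ∀ v ∈ U, ∀ x ∈ U, ∀ y ∈ U, g v x ≠ 0 → g v y ≠ 0 → g v x = g v y := by
  by_cases hcut : BaseCut U E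
  · exact Or.inl hcut
  right
  intro v hv x hx y hy n1 n2
  rcases (hs.mem v).1 hv with q | q
  · obtain ⟨t, ht, n⟩ := hs.exists_ne_zero h hβ q
    rw [hs.mono_left h hcut hα hβ q ht n hx n1, hs.mono_left h hcut hα hβ q ht n hy n2]
  · obtain ⟨t, ht, n⟩ := hs.swap.exists_ne_zero h hα q
    rw [hs.swap.mono_left h hcut hβ hα q ht n hx n1, hs.swap.mono_left h hcut hβ hα q ht n hy n2]

end Star

end PrincipalMinors

namespace PrincipalMinors

/-! ### Triangle signs, normalised entries, and what minors of order at most four say about them. -/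

section Triangles

variable {V F : Type*} [Field F]

/-- The weight of the directed triangle `i → j → k → i`. -/
def cyc (a : V → V → F) (i j k : V) : F := a i j * a j k * a k i

/-- The rows `i, j` and columns `k, l` span a singular `2 × 2` submatrix. -/
def Par (a : V → V → F) (i j k l : V) : Prop := a i k * a j l = a i l * a j k

open Classical in
/-- How `b` treats the triangle `i, j, k` of `a`: it is `0` when both orientations of the triangle
have the same weight, `1` when `b` keeps the orientation and `-1` when `b` reverses it. -/
noncomputable def triSign (a b : V → V → F) (i j k : V) : SignType :=
  if cyc a i j k = cyc a i k j then 0 else if cyc b i j k = cyc a i j k then 1 else -1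

/-- The off-diagonal entry normalised so that the row and the column of `m` become constant. -/
def normEntry (a : V → V → F) (m j k : V) : F := a j k / (a j m * a m k)

/-- Density, the five-point form of rank-one extension, and the relations expressing equality
of the principal minors of order at most four. -/
structure MinorData (a b : V → V → F) : Prop where
  dense : ∀ i j, i ≠ j → a i j ≠ 0
  ext : ∀ i j k l m, i ≠ j → k ≠ l → i ≠ k → i ≠ l → j ≠ k → j ≠ l → m ≠ i → m ≠ j → m ≠ k →
    m ≠ l → Par a i j k l → Par a i m k l ∨ Par a i j k m
  diag : ∀ i, a i i = b i i
  two : ∀ i j, a i j * a j i = b i j * b j i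
  three : ∀ i j k, cyc a i j k + cyc a i k j = cyc b i j k + cyc b i k j
  four : ∀ i j k l, i ≠ j → i ≠ k → i ≠ l → j ≠ k → j ≠ l → k ≠ l →
    a i j * a j k * a k l * a l i + a i l * a l k * a k j * a j i +
    a i j * a j l * a l k * a k i + a i k * a k l * a l j * a j i +
    a i k * a k j * a j l * a l i + a i l * a l j * a j k * a k i =
    b i j * b j k * b k l * b l i + b i l * b l k * b k j * b j i +
    b i j * b j l * b l k * b k i + b i k * b k l * b l j * b j i +
    b i k * b k j * b j l * b l i + b i l * b l j * b j k * b k i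

variable {a b : V → V → F}

theorem MinorData.dense' (h : MinorData a b) {i j : V} (hij : i ≠ j) : b i j ≠ 0 := by
  intro hb
  have := h.two i j
  rw [hb, zero_mul] at this
  exact mul_ne_zero (h.dense i j hij) (h.dense j i hij.symm) this

/-- The two weights have the same sum and product for `a` and `b`, so they are the roots of the same
quadratic. -/
theorem MinorData.cyc_or (h : MinorData a b) (i j k : V) :
    (cyc b i j k = cyc a i j k ∧ cyc b i k j = cyc a i k j) ∨
    (cyc b i j k = cyc a i k j ∧ cyc b i k j = cyc a i j k) := by
  have h3 := h.three i j k
  have h2 : cyc a i j k * cyc a i k j = cyc b i j k * cyc b i k j := by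
    have e : ∀ c : V → V → F, cyc c i j k * cyc c i k j =
        (c i j * c j i) * (c j k * c k j) * (c i k * c k i) := by
      intro c; simp only [cyc]; ring
    rw [e a, e b, h.two i j, h.two j k, h.two i k]
  have : (cyc b i j k - cyc a i j k) * (cyc b i j k - cyc a i k j) = 0 := by grind
  rcases mul_eq_zero.1 this with q | q
  · left; constructor
    · linear_combination q
    · linear_combination -h3 - q
  · right; constructor
    · linear_combination q
    · linear_combination -h3 - q

theorem cyc_rotate (a : V → V → F) (i j k : V) : cyc a j k i = cyc a i j k := by
  simp only [cyc]; ring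

theorem triSign_rotate (a b : V → V → F) (i j k : V) : triSign a b j k i = triSign a b i j k := by
  simp only [triSign]
  rw [cyc_rotate a i j k, cyc_rotate b i j k, ← cyc_rotate a j i k]

theorem MinorData.triSign_swap (h : MinorData a b) (i j k : V) :
    triSign a b i k j = triSign a b i j k := by
  have := h.cyc_or i j k
  simp only [triSign]
  grind

theorem triSign_eq_zero_iff (a b : V → V → F) (i j k : V) :
    triSign a b i j k = 0 ↔ cyc a i j k = cyc a i k j := by
  simp only [triSign]
  split_ifs <;> simp_all

theorem triSign_self (a b : V → V → F) (i j : V) : triSign a b i j j = 0 :=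
  (triSign_eq_zero_iff a b i j j).2 rfl

theorem MinorData.ne_neg_one_iff (h : MinorData a b) (i j k : V) :
    triSign a b i j k ≠ -1 ↔ cyc b i j k = cyc a i j k := by
  have := h.cyc_or i j k
  simp only [triSign]
  split_ifs <;> simp_all

theorem MinorData.ne_one_iff (h : MinorData a b) (i j k : V) :
    triSign a b i j k ≠ 1 ↔ cyc b i j k = cyc a i k j := by
  have := h.cyc_or i j k
  simp only [triSign]
  split_ifs <;> simp_all

theorem normEntry_mul (hd : ∀ i j, i ≠ j → a i j ≠ 0) {m j k : V} (hj : j ≠ m) (hk : k ≠ m) :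
    a j k = normEntry a m j k * (a j m * a m k) := by
  have := hd j m hj
  have := hd m k hk.symm
  rw [normEntry]; field_simp

theorem normEntry_ne_zero (hd : ∀ i j, i ≠ j → a i j ≠ 0) {m j k : V} (hj : j ≠ m) (hk : k ≠ m)
    (hjk : j ≠ k) : normEntry a m j k ≠ 0 :=
  div_ne_zero (hd _ _ hjk) (mul_ne_zero (hd _ _ hj) (hd _ _ hk.symm))

theorem cyc_eq_normEntry (hd : ∀ i j, i ≠ j → a i j ≠ 0) {m j k : V} (hj : j ≠ m) (hk : k ≠ m) :
    cyc a m j k = normEntry a m j k * ((a m j * a j m) * (a m k * a k m)) := by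
  rw [cyc, normEntry_mul hd hj hk]; ring

theorem cyc_eq_normEntry' (hd : ∀ i j, i ≠ j → a i j ≠ 0) {m i j k : V} (hi : i ≠ m) (hj : j ≠ m)
    (hk : k ≠ m) : cyc a i j k = normEntry a m i j * normEntry a m j k * normEntry a m k i *
      ((a m i * a i m) * (a m j * a j m) * (a m k * a k m)) := by
  rw [cyc, normEntry_mul hd hi hj, normEntry_mul hd hj hk, normEntry_mul hd hk hi]; ring

theorem par_row_iff (hd : ∀ i j, i ≠ j → a i j ≠ 0) {m s j k : V} (hs : s ≠ m) (hj : j ≠ m)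
    (hk : k ≠ m) : Par a m s j k ↔ normEntry a m s j = normEntry a m s k := by
  have h1 := hd s m hs
  have h2 := hd m j hj.symm
  have h3 := hd m k hk.symm
  rw [Par, normEntry_mul hd hs hj, normEntry_mul hd hs hk]
  constructor
  · intro e
    have : (a m j * a s m * a m k) * (normEntry a m s j - normEntry a m s k) = 0 := by
      linear_combination -e
    have := (mul_eq_zero.1 this).resolve_left (by positivity)
    exact sub_eq_zero.1 this
  · intro e; rw [e]; ring

theorem par_col_iff (hd : ∀ i j, i ≠ j → a i j ≠ 0) {m s j k : V} (hs : s ≠ m) (hj : j ≠ m)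
    (hk : k ≠ m) : Par a j k m s ↔ normEntry a m j s = normEntry a m k s := by
  have h1 := hd m s hs.symm
  have h2 := hd j m hj
  have h3 := hd k m hk
  rw [Par, normEntry_mul hd hj hs, normEntry_mul hd hk hs]
  constructor
  · intro e
    have : (a m s * a j m * a k m) * (normEntry a m j s - normEntry a m k s) = 0 := by
      linear_combination -e
    have := (mul_eq_zero.1 this).resolve_left (by positivity)
    exact sub_eq_zero.1 this
  · intro e; rw [e]; ring

theorem par_iff (hd : ∀ i j, i ≠ j → a i j ≠ 0) {m i j k l : V} (hi : i ≠ m) (hj : j ≠ m)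
    (hk : k ≠ m) (hl : l ≠ m) : Par a i j k l ↔
      normEntry a m i k * normEntry a m j l = normEntry a m i l * normEntry a m j k := by
  have h1 := hd i m hi
  have h2 := hd j m hj
  have h3 := hd m k hk.symm
  have h4 := hd m l hl.symm
  rw [Par, normEntry_mul hd hi hk, normEntry_mul hd hj hl, normEntry_mul hd hi hl,
    normEntry_mul hd hj hk]
  constructor
  · intro e
    have : (a i m * a j m * a m k * a m l) * (normEntry a m i k * normEntry a m j l -
        normEntry a m i l * normEntry a m j k) = 0 := by
      linear_combination e
    have := (mul_eq_zero.1 this).resolve_left (by positivity)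
    exact sub_eq_zero.1 this
  · intro e; linear_combination (a i m * a j m * a m k * a m l) * e

theorem Par.swap_rows {i j k l : V} (h : Par a i j k l) : Par a j i k l := by
  simp only [Par] at *; linear_combination -h

theorem Par.swap_cols {i j k l : V} (h : Par a i j k l) : Par a i j l k := by
  simp only [Par] at *; linear_combination -h

theorem MinorData.two_cycle_ne (h : MinorData a b) {m j : V} (hj : j ≠ m) :
    a m j * a j m ≠ 0 := mul_ne_zero (h.dense _ _ hj.symm) (h.dense _ _ hj)

/-- The weight of `m, j, k` is the normalised entry times a product of two-cycles, which is
symmetric in `j, k` and common to `a` and `b`. So signs at `m` tell, pair by pair, whether `b`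
copies or transposes the normalised entries of `a`. -/
theorem MinorData.normEntry_or (h : MinorData a b) {m j k : V} (hj : j ≠ m) (hk : k ≠ m) :
    (triSign a b m j k = 0 ↔ normEntry a m j k = normEntry a m k j) ∧
    (triSign a b m j k ≠ -1 ↔ normEntry b m j k = normEntry a m j k) ∧
    (triSign a b m j k ≠ 1 ↔ normEntry b m j k = normEntry a m k j) := by
  have hb : ∀ i j, i ≠ j → b i j ≠ 0 := fun i j hij => h.dense' hij
  have p : (a m j * a j m) * (a m k * a k m) ≠ 0 :=
    mul_ne_zero (h.two_cycle_ne hj) (h.two_cycle_ne hk)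
  have e : cyc a m k j = normEntry a m k j * ((a m j * a j m) * (a m k * a k m)) := by
    rw [cyc_eq_normEntry h.dense hk hj]; ring
  rw [triSign_eq_zero_iff, h.ne_neg_one_iff, h.ne_one_iff, cyc_eq_normEntry h.dense hj hk, e,
    cyc_eq_normEntry hb hj hk, ← h.two m j, ← h.two m k, mul_left_inj' p, mul_left_inj' p,
    mul_left_inj' p]
  exact ⟨Iff.rfl, Iff.rfl, Iff.rfl⟩

/-- Here `x, x'` is the pair `j k`, which `b` keeps, `y, y'` the pair `j l`, which `b` transposes,
and `z, z'` and `w, w'` are the pair `k l` in `a` and in `b`. In the two cases of `hz` both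
identities factor through `y - y'` and `x - x'` respectively. -/
theorem tri_algebra {x x' y y' z z' w w' : F} (hx : x ≠ x') (hy : y ≠ y')
    (hz : (w = z ∧ w' = z') ∨ (w = z' ∧ w' = z))
    (h3 : x * z * y' + y * z' * x' = x * w * y + y' * w' * x')
    (h4 : x * z + z' * x' + y * z' + z * y' + x' * y + y' * x =
      x * w + w' * x' + y' * w' + w * y + x' * y' + y * x) :
    (w = z ∧ z = x' ∧ z' = x) ∨ (w = z' ∧ w' = z ∧ z = y ∧ z' = y') := by
  have hx' : x - x' ≠ 0 := sub_ne_zero.2 hx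
  have hy' : y - y' ≠ 0 := sub_ne_zero.2 hy
  rcases hz with ⟨rfl, rfl⟩ | ⟨rfl, rfl⟩
  · left
    have e1 : w' - w = x - x' := by
      have : (y - y') * (w' - w - (x - x')) = 0 := by linear_combination h4
      have := (mul_eq_zero.1 this).resolve_left hy'
      linear_combination this
    have e2 : w' * x' = x * w := by
      have : (y - y') * (w' * x' - x * w) = 0 := by linear_combination h3
      have := (mul_eq_zero.1 this).resolve_left hy'
      linear_combination this
    have e3 : w = x' := by
      have : (x - x') * (w - x') = 0 := by linear_combination -e2 + x' * e1
      have := (mul_eq_zero.1 this).resolve_left hx'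
      linear_combination this
    exact ⟨rfl, e3, by linear_combination e1 + e3⟩
  · right
    have e1 : w' - w = y - y' := by
      have : (x - x') * (w' - w - (y - y')) = 0 := by linear_combination h4
      have := (mul_eq_zero.1 this).resolve_left hx'
      linear_combination this
    have e2 : w' * y' = y * w := by
      have : (x - x') * (w' * y' - y * w) = 0 := by linear_combination h3
      have := (mul_eq_zero.1 this).resolve_left hx'
      linear_combination this
    have e3 : w = y' := by
      have : (y - y') * (w - y') = 0 := by linear_combination -e2 + y' * e1
      have := (mul_eq_zero.1 this).resolve_left hy'
      linear_combination this
    exact ⟨rfl, rfl, by linear_combination e1 + e3, e3⟩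

theorem MinorData.normEntry_three (h : MinorData a b) {m j k l : V} (hj : j ≠ m) (hk : k ≠ m)
    (hl : l ≠ m) :
    normEntry a m j k * normEntry a m k l * normEntry a m l j +
      normEntry a m j l * normEntry a m l k * normEntry a m k j =
    normEntry b m j k * normEntry b m k l * normEntry b m l j +
      normEntry b m j l * normEntry b m l k * normEntry b m k j := by
  have hb : ∀ i j, i ≠ j → b i j ≠ 0 := fun i j hij => h.dense' hij
  have p : (a m j * a j m) * (a m k * a k m) * (a m l * a l m) ≠ 0 :=
    mul_ne_zero (mul_ne_zero (h.two_cycle_ne hj) (h.two_cycle_ne hk)) (h.two_cycle_ne hl)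
  have e := h.three j k l
  rw [cyc_eq_normEntry' h.dense hj hk hl, cyc_eq_normEntry' h.dense hj hl hk,
    cyc_eq_normEntry' hb hj hk hl, cyc_eq_normEntry' hb hj hl hk, ← h.two m j, ← h.two m k,
    ← h.two m l] at e
  apply mul_left_cancel₀ p
  linear_combination e

/-- Normalisation at `m` turns four-cycles through `m` into two-step paths, up to a common factor.
-/
theorem MinorData.normEntry_four (h : MinorData a b) {m j k l : V} (hj : j ≠ m) (hk : k ≠ m)
    (hl : l ≠ m) (hjk : j ≠ k) (hjl : j ≠ l) (hkl : k ≠ l) :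
    normEntry a m j k * normEntry a m k l + normEntry a m l k * normEntry a m k j +
      normEntry a m j l * normEntry a m l k + normEntry a m k l * normEntry a m l j +
      normEntry a m k j * normEntry a m j l + normEntry a m l j * normEntry a m j k =
    normEntry b m j k * normEntry b m k l + normEntry b m l k * normEntry b m k j +
      normEntry b m j l * normEntry b m l k + normEntry b m k l * normEntry b m l j +
      normEntry b m k j * normEntry b m j l + normEntry b m l j * normEntry b m j k := by
  have hb : ∀ i j, i ≠ j → b i j ≠ 0 := fun i j hij => h.dense' hij
  have p : (a m j * a j m) * (a m k * a k m) * (a m l * a l m) ≠ 0 :=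
    mul_ne_zero (mul_ne_zero (h.two_cycle_ne hj) (h.two_cycle_ne hk)) (h.two_cycle_ne hl)
  have path : ∀ c : V → V → F, (∀ i j, i ≠ j → c i j ≠ 0) → ∀ x y z : V, x ≠ m → y ≠ m → z ≠ m →
      c m x * c x y * c y z * c z m = normEntry c m x y * normEntry c m y z *
        ((c m x * c x m) * (c m y * c y m) * (c m z * c z m)) := by
    intro c hc x y z hx hy hz
    rw [normEntry_mul hc hx hy, normEntry_mul hc hy hz]; ring
  have e := h.four m j k l hj.symm hk.symm hl.symm hjk hjl hkl
  rw [path a h.dense j k l hj hk hl, path a h.dense l k j hl hk hj, path a h.dense j l k hj hl hk,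
    path a h.dense k l j hk hl hj, path a h.dense k j l hk hj hl, path a h.dense l j k hl hj hk,
    path b hb j k l hj hk hl, path b hb l k j hl hk hj, path b hb j l k hj hl hk,
    path b hb k l j hk hl hj, path b hb k j l hk hj hl, path b hb l j k hl hj hk,
    ← h.two m j, ← h.two m k, ← h.two m l] at e
  apply mul_left_cancel₀ p
  linear_combination e

theorem MinorData.tri (h : MinorData a b) {m j k l : V} (hj : j ≠ m) (hk : k ≠ m) (hl : l ≠ m)
    (c1 : triSign a b m j k = 1) (c2 : triSign a b m j l = -1) :
    (triSign a b m k l = 1 ∧ normEntry a m k j = normEntry a m k l ∧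
      normEntry a m j k = normEntry a m l k) ∨
    (triSign a b m k l = -1 ∧ normEntry a m l j = normEntry a m l k ∧
      normEntry a m j l = normEntry a m k l) := by
  have hjk : j ≠ k := by
    rintro rfl; rw [triSign_self] at c1; exact absurd c1 (by decide)
  have hjl : j ≠ l := by
    rintro rfl; rw [triSign_self] at c2; exact absurd c2 (by decide)
  have hkl : k ≠ l := by
    rintro rfl; rw [c1] at c2; exact absurd c2 (by decide)
  obtain ⟨a1, a2, -⟩ := h.normEntry_or hj hk
  obtain ⟨-, a2', -⟩ := h.normEntry_or hk hj
  obtain ⟨b1, -, b3⟩ := h.normEntry_or hj hl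
  obtain ⟨-, -, b3'⟩ := h.normEntry_or hl hj
  obtain ⟨d1, d2, d3⟩ := h.normEntry_or hk hl
  obtain ⟨-, d2', d3'⟩ := h.normEntry_or hl hk
  rw [h.triSign_swap] at a2' b3' d2' d3'
  have n1 : normEntry a m j k ≠ normEntry a m k j := fun e => by
    rw [← a1, c1] at e; exact absurd e (by decide)
  have n2 : normEntry a m j l ≠ normEntry a m l j := fun e => by
    rw [← b1, c2] at e; exact absurd e (by decide)
  have f1 := a2.1 (by rw [c1]; decide)
  have f1' := a2'.1 (by rw [c1]; decide)
  have f2 := b3.1 (by rw [c2]; decide)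
  have f2' := b3'.1 (by rw [c2]; decide)
  have hz : (normEntry b m k l = normEntry a m k l ∧ normEntry b m l k = normEntry a m l k) ∨
      (normEntry b m k l = normEntry a m l k ∧ normEntry b m l k = normEntry a m k l) := by
    by_cases q : triSign a b m k l = -1
    · right; exact ⟨d3.1 (by rw [q]; decide), d3'.1 (by rw [q]; decide)⟩
    · left; exact ⟨d2.1 q, d2'.1 q⟩
  have h3 := h.normEntry_three hj hk hl
  have h4 := h.normEntry_four hj hk hl hjk hjl hkl
  rw [f1, f1', f2, f2'] at h3 h4
  have key : ∀ c : SignType, c ≠ -1 → c ≠ 0 → c = 1 := by decide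
  have key' : ∀ c : SignType, c ≠ 1 → c ≠ 0 → c = -1 := by decide
  rcases tri_algebra n1 n2 hz (by linear_combination h3) (by linear_combination h4) with
    ⟨e1, e2, e3⟩ | ⟨e1, e1', e2, e3⟩
  · left
    refine ⟨key _ (d2.2 e1) ?_, e2.symm, e3.symm⟩
    rw [Ne, d1, e2, e3]; exact n1.symm
  · right
    refine ⟨key' _ (d3.2 e1) ?_, e3.symm, e2.symm⟩
    rw [Ne, d1, e2, e3]; exact n2

theorem MinorData.isColored (h : MinorData a b) {U : Finset V} {m : V} (hm : m ∉ U) :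
    IsColored U (normEntry a m) (triSign a b m) where
  symm j k := h.triSign_swap m k j
  diag j := triSign_self a b m j
  zero j hj k hk _ :=
    (h.normEntry_or (ne_of_mem_of_not_mem hj hm) (ne_of_mem_of_not_mem hk hm)).1
  tri j hj k hk l hl c1 c2 c3 := by
    have nj : j ≠ m := fun e => hm (e ▸ hj)
    have nk : k ≠ m := fun e => hm (e ▸ hk)
    have nl : l ≠ m := fun e => hm (e ▸ hl)
    have key : ∀ c d : SignType, c ≠ 0 → d ≠ 0 → c ≠ d → (c = 1 ∧ d = -1) ∨ (c = -1 ∧ d = 1) := by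
      decide
    rcases key _ _ c1 c2 c3 with ⟨q1, q2⟩ | ⟨q1, q2⟩
    · have := h.tri nj nk nl q1 q2
      rw [q1, q2]; tauto
    · have := h.tri nj nl nk q2 q1
      rw [h.triSign_swap m k l] at this
      rw [q1, q2]; tauto
  row s hs j hj k hk v hv n1 n2 n3 n4 n5 n6 e := by
    have nj : j ≠ m := fun e => hm (e ▸ hj)
    have nk : k ≠ m := fun e => hm (e ▸ hk)
    have ns : s ≠ m := fun e => hm (e ▸ hs)
    have nv : v ≠ m := fun e => hm (e ▸ hv)
    rcases h.ext m s j k v ns.symm n4 nj.symm nk.symm n1 n2 nv n3.symm n5.symm n6.symm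
      ((par_row_iff h.dense ns nj nk).2 e) with q | q
    · exact Or.inr ((par_row_iff h.dense nv nj nk).1 q)
    · exact Or.inl ((par_row_iff h.dense ns nj nv).1 q).symm
  col s hs j hj k hk v hv n1 n2 n3 n4 n5 n6 e := by
    have nj : j ≠ m := fun e => hm (e ▸ hj)
    have nk : k ≠ m := fun e => hm (e ▸ hk)
    have ns : s ≠ m := fun e => hm (e ▸ hs)
    have nv : v ≠ m := fun e => hm (e ▸ hv)
    rcases h.ext j k m s v n4 ns.symm nj n1.symm nk n2.symm n5.symm n6.symm nv n3.symm
      ((par_col_iff h.dense ns nj nk).2 e) with q | q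
    · exact Or.inl ((par_col_iff h.dense ns nj nv).1 q).symm
    · exact Or.inr ((par_col_iff h.dense nv nj nk).1 q)

/-- If no triangle at `m` is reversed then no triangle is. -/
theorem MinorData.ne_neg_one_of_base (h : MinorData a b) {m i j k : V}
    (h1 : triSign a b m i j ≠ -1) (h2 : triSign a b m j k ≠ -1) (h3 : triSign a b m i k ≠ -1) :
    triSign a b i j k ≠ -1 := by
  have hb : ∀ i j, i ≠ j → b i j ≠ 0 := fun i j hij => h.dense' hij
  by_cases hi : i = m
  · subst hi; exact h2
  by_cases hj : j = m
  · subst hj; rw [← triSign_rotate]; rwa [h.triSign_swap]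
  by_cases hk : k = m
  · subst hk; rwa [← triSign_rotate, ← triSign_rotate]
  rw [h.ne_neg_one_iff, cyc_eq_normEntry' h.dense hi hj hk, cyc_eq_normEntry' hb hi hj hk,
    ← h.two m i, ← h.two m j, ← h.two m k, (h.normEntry_or hi hj).2.1.1 h1,
    (h.normEntry_or hj hk).2.1.1 h2,
    (h.normEntry_or hk hi).2.1.1 (by rw [h.triSign_swap]; exact h3)]

/-- If no triangle at `m` is kept then no triangle is. -/
theorem MinorData.ne_one_of_base (h : MinorData a b) {m i j k : V}
    (h1 : triSign a b m i j ≠ 1) (h2 : triSign a b m j k ≠ 1) (h3 : triSign a b m i k ≠ 1) :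
    triSign a b i j k ≠ 1 := by
  have hb : ∀ i j, i ≠ j → b i j ≠ 0 := fun i j hij => h.dense' hij
  by_cases hi : i = m
  · subst hi; exact h2
  by_cases hj : j = m
  · subst hj; rw [← triSign_rotate]; rwa [h.triSign_swap]
  by_cases hk : k = m
  · subst hk; rwa [← triSign_rotate, ← triSign_rotate]
  rw [h.ne_one_iff, cyc_eq_normEntry' h.dense hi hk hj, cyc_eq_normEntry' hb hi hj hk,
    ← h.two m i, ← h.two m j, ← h.two m k, (h.normEntry_or hi hj).2.2.1 h1,
    (h.normEntry_or hj hk).2.2.1 h2,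
    (h.normEntry_or hk hi).2.2.1 (by rw [h.triSign_swap]; exact h3)]
  ring

/-- Both orientations of `i, j, k` contain the symmetric entries at `i` as a common factor, so they
differ exactly when the entries of `j k` do. -/
theorem MinorData.ne_zero_of_base (h : MinorData a b) {m i j k : V}
    (h1 : triSign a b m i j = 0) (h2 : triSign a b m i k = 0) (h3 : triSign a b m j k ≠ 0) :
    triSign a b i j k ≠ 0 := by
  have nz : ∀ x y, triSign a b x y x = 0 := fun x y => by
    rw [triSign_eq_zero_iff]; simp only [cyc]; ring
  by_cases hi : i = m
  · subst hi; exact h3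
  by_cases hj : j = m
  · subst hj; rw [← triSign_rotate, nz] at h3; exact absurd rfl h3
  by_cases hk : k = m
  · subst hk; rw [nz] at h3; exact absurd rfl h3
  rw [(h.normEntry_or hi hj).1] at h1
  rw [(h.normEntry_or hi hk).1] at h2
  rw [Ne, (h.normEntry_or hj hk).1] at h3
  rw [Ne, triSign_eq_zero_iff, cyc_eq_normEntry' h.dense hi hk hj,
    cyc_eq_normEntry' h.dense hi hj hk, ← h1, ← h2]
  intro e
  apply h3
  have hij : i ≠ j := by
    rintro rfl; exact h3 h2
  have hik : i ≠ k := by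
    rintro rfl; exact h3 h1.symm
  have p : (a m i * a i m) * (a m j * a j m) * (a m k * a k m) * (normEntry a m i j *
      normEntry a m i k) ≠ 0 :=
    mul_ne_zero (mul_ne_zero (mul_ne_zero (h.two_cycle_ne hi) (h.two_cycle_ne hj))
      (h.two_cycle_ne hk)) (mul_ne_zero (normEntry_ne_zero h.dense hi hj hij)
      (normEntry_ne_zero h.dense hi hk hik))
  apply mul_left_cancel₀ p
  linear_combination e

end Triangles

end PrincipalMinors

namespace PrincipalMinors

/-! ### Every index set is coherent or has a cut. -/

section Cuts

variable {V F : Type*} [Field F] [DecidableEq V]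

/-- `W` is partitioned into two sets with at least two elements, such that both off-diagonal
blocks of `a` have rank one. -/
def HasCut (a : V → V → F) (W : Finset V) : Prop :=
  ∃ S T : Finset V, Disjoint S T ∧ S ∪ T = W ∧ (∃ x ∈ S, ∃ y ∈ S, x ≠ y) ∧
    (∃ x ∈ T, ∃ y ∈ T, x ≠ y) ∧
    ∀ i ∈ S, ∀ j ∈ S, ∀ k ∈ T, ∀ l ∈ T, Par a i j k l ∧ Par a k l i j

/-- `b` keeps all triangles in `W`, or reverses all of them. -/
def Coherent (a b : V → V → F) (W : Finset V) : Prop :=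
  (∀ i ∈ W, ∀ j ∈ W, ∀ k ∈ W, triSign a b i j k ≠ -1) ∨
  (∀ i ∈ W, ∀ j ∈ W, ∀ k ∈ W, triSign a b i j k ≠ 1)

variable {a b : V → V → F}

theorem MinorData.hasCut_of_baseCut (h : MinorData a b) {W : Finset V} {m : V} (hm : m ∈ W)
    (hc : BaseCut (W.erase m) (normEntry a m)) : HasCut a W := by
  obtain ⟨D, hD, hD2, ⟨w, hw, hwD⟩, hcut⟩ := hc
  have hmD : m ∉ D := fun q => (Finset.mem_erase.1 (hD q)).1 rfl
  have hDW : D ⊆ W := hD.trans (Finset.erase_subset _ _)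
  refine ⟨W \ D, D, Finset.sdiff_disjoint, Finset.sdiff_union_of_subset hDW,
    ⟨m, Finset.mem_sdiff.2 ⟨hm, hmD⟩, w, Finset.mem_sdiff.2 ⟨(Finset.mem_erase.1 hw).2, hwD⟩,
      (Finset.mem_erase.1 hw).1.symm⟩, hD2, ?_⟩
  intro i hi j hj k hk l hl
  have hi' := Finset.mem_sdiff.1 hi
  have hj' := Finset.mem_sdiff.1 hj
  have hkm : k ≠ m := ne_of_mem_of_not_mem hk hmD
  have hlm : l ≠ m := ne_of_mem_of_not_mem hl hmD
  have C : ∀ u, u ∈ W → u ∉ D → u ≠ m → normEntry a m u k = normEntry a m u l ∧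
      normEntry a m k u = normEntry a m l u := fun u h1 h2 h3 =>
    hcut u (Finset.mem_erase.2 ⟨h3, h1⟩) h2 k hk l hl
  by_cases him : i = m
  · subst him
    by_cases hjm : j = i
    · subst hjm
      exact ⟨by simp only [Par]; ring, by simp only [Par]⟩
    · have c := C j hj'.1 hj'.2 hjm
      exact ⟨(par_row_iff h.dense hjm hkm hlm).2 c.1, (par_col_iff h.dense hjm hkm hlm).2 c.2⟩
  · have ci := C i hi'.1 hi'.2 him
    by_cases hjm : j = m
    · subst hjm
      exact ⟨((par_row_iff h.dense him hkm hlm).2 ci.1).swap_rows,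
        ((par_col_iff h.dense him hkm hlm).2 ci.2).swap_cols⟩
    · have cj := C j hj'.1 hj'.2 hjm
      refine ⟨(par_iff h.dense him hjm hkm hlm).2 ?_, (par_iff h.dense hkm hlm him hjm).2 ?_⟩
      · rw [ci.1, cj.1]
      · rw [ci.2, cj.2]; ring

/-- If all triangles at each edge through `m` are treated alike, then `b` is coherent, or `a` has
a cut. -/
theorem MinorData.coherent_or_hasCut_of_mono (h : MinorData a b) {W : Finset V} {m : V}
    (hmono : ∀ v ∈ W, ∀ x ∈ W, ∀ y ∈ W, triSign a b m v x ≠ 0 →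
      triSign a b m v y ≠ 0 → triSign a b m v x = triSign a b m v y) :
    Coherent a b W ∨ HasCut a W := by
  by_cases hp : ∀ x ∈ W, ∀ y ∈ W, triSign a b m x y ≠ 1
  · exact Or.inl (Or.inr fun i hi j hj k hk =>
      h.ne_one_of_base (hp i hi j hj) (hp j hj k hk) (hp i hi k hk))
  by_cases hn : ∀ x ∈ W, ∀ y ∈ W, triSign a b m x y ≠ -1
  · exact Or.inl (Or.inl fun i hi j hj k hk =>
      h.ne_neg_one_of_base (hn i hi j hj) (hn j hj k hk) (hn i hi k hk))
  right
  push Not at hp hn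
  obtain ⟨x, hx, y, hy, hxy⟩ := hp
  obtain ⟨z, hz, w, hw, hzw⟩ := hn
  have sy : ∀ i j, triSign a b m i j = triSign a b m j i := fun i j => h.triSign_swap m j i
  have tri3 : ∀ c : SignType, c ≠ 1 → c ≠ -1 → c = 0 := by decide
  have tri1 : ∀ c : SignType, c ≠ 0 → c ≠ -1 → c = 1 := by decide
  have pos : ∀ v ∈ W, ∀ u ∈ W, triSign a b m v u = 1 → ∀ t ∈ W, triSign a b m v t ≠ -1 := by
    intro v hv u hu huv t ht q
    have := hmono v hv u hu t ht (by rw [huv]; decide) (by rw [q]; decide)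
    rw [huv, q] at this; exact absurd this (by decide)
  have neg : ∀ v ∈ W, ∀ u ∈ W, triSign a b m v u = -1 → ∀ t ∈ W, triSign a b m v t ≠ 1 :=
    fun v hv u hu huv t ht q => pos v hv t ht q u hu huv
  have hyx : triSign a b m y x = 1 := (sy y x).trans hxy
  have hwz : triSign a b m w z = -1 := (sy w z).trans hzw
  -- Positive and negative edges at `m` span disjoint vertex sets, with only colour 0 between them.
  have z0 : ∀ v ∈ W, ∀ u ∈ W, triSign a b m v u = 1 → triSign a b m z v = 0 := by
    intro v hv u hu hvu
    exact tri3 _ (neg z hz w hw hzw v hv) (by rw [sy]; exact pos v hv u hu hvu z hz)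
  have zx := z0 x hx y hy hxy
  have zy := z0 y hy x hx hyx
  have xw : triSign a b m x w = 0 :=
    tri3 _ (by rw [sy]; exact neg w hw z hz hwz x hx) (pos x hx y hy hxy w hw)
  have zxy : triSign a b z x y = 1 := by
    refine tri1 _ (h.ne_zero_of_base zx zy (by rw [hxy]; decide)) (h.ne_neg_one_of_base (m := m)
      ?_ ?_ ?_)
    · rw [zx]; decide
    · rw [hxy]; decide
    · rw [zy]; decide
  have zxw : triSign a b z x w ≠ 0 := by
    rw [← triSign_rotate]
    exact h.ne_zero_of_base xw ((sy x z).trans zx) (by rw [hwz]; decide)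
  have nez : ∀ u v, triSign a b z u v ≠ 0 → u ≠ z := by
    rintro u v q rfl
    apply q
    rw [← triSign_rotate, triSign_eq_zero_iff]; simp only [cyc]; ring
  have zwx : triSign a b z w x ≠ 0 := by rwa [h.triSign_swap]
  have zyx : triSign a b z y x ≠ 0 := by rw [h.triSign_swap, zxy]; decide
  -- Change the base to `z`, an end of a negative edge. The positive component of `x` seen from `z`
  -- stays among the vertices on positive edges at `m`, hence misses `w`.
  refine h.hasCut_of_baseCut hz ((h.isColored (Finset.notMem_erase z W)).baseCut_of_closed
    (ε := 1) (by decide) (t := x) (s := y) (w := w)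
    (P := fun v => ∃ u ∈ W, triSign a b m v u = 1)
    (Finset.mem_erase.2 ⟨nez _ _ zxw, hx⟩) (Finset.mem_erase.2 ⟨nez _ _ zyx, hy⟩)
    (Finset.mem_erase.2 ⟨nez _ _ zwx, hw⟩) zxy zxw ⟨y, hy, hxy⟩ ?_ ?_)
  · rintro ⟨u, hu, q⟩
    exact neg w hw z hz hwz u hu q
  · rintro v hv u hu ⟨t, ht, hvt⟩ hzvu
    have hvW := Finset.mem_of_mem_erase hv
    have huW := Finset.mem_of_mem_erase hu
    refine ⟨v, hvW, ?_⟩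
    rw [sy]
    refine tri1 _ (fun q => ?_) (pos v hvW t ht hvt u huW)
    refine h.ne_one_of_base (m := m) ?_ ?_ ?_ hzvu
    · rw [z0 v hvW t ht hvt]; decide
    · rw [q]; decide
    · exact neg z hz w hw hzw u huW

omit [DecidableEq V] in
/-- A rank-one block `S × T` extends by the base index to one of its two sides. -/
theorem const_rows_or_cols {E : V → V → F} {S T : Finset V}
    (hne : ∀ s ∈ S, ∀ t ∈ T, E s t ≠ 0)
    (hpar : ∀ s ∈ S, ∀ s' ∈ S, ∀ t ∈ T, ∀ t' ∈ T, E s t * E s' t' = E s t' * E s' t)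
    (hext : ∀ s ∈ S, ∀ s' ∈ S, ∀ t ∈ T, ∀ t' ∈ T, E s t = E s t' ∨ E s t = E s' t) :
    (∀ s ∈ S, ∀ t ∈ T, ∀ t' ∈ T, E s t = E s t') ∨
    (∀ t ∈ T, ∀ s ∈ S, ∀ s' ∈ S, E s t = E s' t) := by
  by_cases hr : ∀ s ∈ S, ∀ t ∈ T, ∀ t' ∈ T, E s t = E s t'
  · exact Or.inl hr
  right
  push Not at hr
  obtain ⟨s₁, hs₁, t₁, ht₁, t₂, ht₂, hne12⟩ := hr
  -- A nonconstant row forces column `t₁` to be constant; rank one then makes all rows equal.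
  have c1 : ∀ s ∈ S, E s t₁ = E s₁ t₁ := fun s hs =>
    ((hext s₁ hs₁ s hs t₁ ht₁ t₂ ht₂).resolve_left hne12).symm
  have c2 : ∀ t ∈ T, ∀ s ∈ S, E s t = E s₁ t := by
    intro t ht s hs
    have e := hpar s hs s₁ hs₁ t₁ ht₁ t ht
    rw [c1 s hs] at e
    have n := hne s₁ hs₁ t₁ ht₁
    apply mul_right_cancel₀ n
    linear_combination -e
  intro t ht s hs s' hs'
  rw [c2 t ht s hs, c2 t ht s' hs']

/-- Each of the two blocks absorbs `m` as a row or as a column. If `m` joins the same side both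
times, the cut extends to `W`; otherwise there is a star, for the entries or for their transpose. A
star with constant `α` or `β` is again an extended cut. -/
theorem MinorData.hasCut_or_mono_of_erase (h : MinorData a b) {W : Finset V} {m : V} (hm : m ∈ W)
    (hc : HasCut a (W.erase m)) : HasCut a W ∨ ∀ v ∈ W, ∀ x ∈ W, ∀ y ∈ W,
      triSign a b m v x ≠ 0 → triSign a b m v y ≠ 0 → triSign a b m v x = triSign a b m v y := by
  obtain ⟨S, T, hdis, hU, hS2, hT2, hpar⟩ := hc
  have hcol := h.isColored (Finset.notMem_erase m W)
  have mem : ∀ v, v ∈ W.erase m ↔ v ∈ S ∨ v ∈ T := fun v => by rw [← hU, Finset.mem_union]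
  have Sm : ∀ s ∈ S, s ≠ m := fun s hs => (Finset.mem_erase.1 ((mem s).2 (Or.inl hs))).1
  have Tm : ∀ s ∈ T, s ≠ m := fun s hs => (Finset.mem_erase.1 ((mem s).2 (Or.inr hs))).1
  have ST : ∀ s ∈ S, ∀ t ∈ T, s ≠ t := fun s hs t ht => Finset.disjoint_iff_ne.1 hdis s hs t ht
  have step : ∀ S T : Finset V, (∀ s ∈ S, s ≠ m) → (∀ t ∈ T, t ≠ m) →
      (∀ s ∈ S, ∀ t ∈ T, s ≠ t) →
      (∀ i ∈ S, ∀ j ∈ S, ∀ k ∈ T, ∀ l ∈ T, Par a i j k l) →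
      (∀ s ∈ S, ∀ t ∈ T, ∀ t' ∈ T, normEntry a m s t = normEntry a m s t') ∨
      (∀ t ∈ T, ∀ s ∈ S, ∀ s' ∈ S, normEntry a m s t = normEntry a m s' t) := by
    intro S T Sm Tm ST hpar
    refine const_rows_or_cols (fun s hs t ht => normEntry_ne_zero h.dense (Sm s hs) (Tm t ht)
      (ST s hs t ht)) (fun s hs s' hs' t ht t' ht' => (par_iff h.dense (Sm s hs) (Sm s' hs')
      (Tm t ht) (Tm t' ht')).1 (hpar s hs s' hs' t ht t' ht')) ?_
    intro s hs s' hs' t ht t' ht'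
    by_cases h1 : s = s'
    · subst h1; exact Or.inr rfl
    by_cases h2 : t = t'
    · subst h2; exact Or.inl rfl
    rcases h.ext s s' t t' m h1 h2 (ST s hs t ht) (ST s hs t' ht') (ST s' hs' t ht)
      (ST s' hs' t' ht') (Sm s hs).symm (Sm s' hs').symm (Tm t ht).symm (Tm t' ht').symm
      (hpar s hs s' hs' t ht t' ht') with q | q
    · exact Or.inl ((par_row_iff h.dense (Sm s hs) (Tm t ht) (Tm t' ht')).1 q.swap_rows)
    · exact Or.inr ((par_col_iff h.dense (Tm t ht) (Sm s hs) (Sm s' hs')).1 q.swap_cols)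
  obtain ⟨s₀, hs₀, s₁, hs₁, hs01⟩ := hS2
  obtain ⟨t₀, ht₀, t₁, ht₁, ht01⟩ := hT2
  have out := step S T Sm Tm ST fun i hi j hj k hk l hl => (hpar i hi j hj k hk l hl).1
  have back := step T S Tm Sm (fun t ht s hs => (ST s hs t ht).symm)
    fun k hk l hl i hi j hj => (hpar i hi j hj k hk l hl).2
  -- both extensions on the side of `S`
  have cutT : (∀ s ∈ S, ∀ t ∈ T, ∀ t' ∈ T, normEntry a m s t = normEntry a m s t') →
      (∀ s ∈ S, ∀ t ∈ T, ∀ t' ∈ T, normEntry a m t s = normEntry a m t' s) → HasCut a W := by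
    intro h1 h2
    refine h.hasCut_of_baseCut hm ⟨T, fun t ht => (mem t).2 (Or.inr ht), ⟨t₀, ht₀, t₁, ht₁, ht01⟩,
      ⟨s₀, (mem s₀).2 (Or.inl hs₀), fun q => ST s₀ hs₀ s₀ q rfl⟩, ?_⟩
    intro u hu hu' x hx y hy
    have hu'' := ((mem u).1 hu).resolve_right hu'
    exact ⟨h1 u hu'' x hx y hy, h2 u hu'' x hx y hy⟩
  have cutS : (∀ t ∈ T, ∀ s ∈ S, ∀ s' ∈ S, normEntry a m t s = normEntry a m t s') →
      (∀ t ∈ T, ∀ s ∈ S, ∀ s' ∈ S, normEntry a m s t = normEntry a m s' t) → HasCut a W := by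
    intro h1 h2
    refine h.hasCut_of_baseCut hm ⟨S, fun t ht => (mem t).2 (Or.inl ht), ⟨s₀, hs₀, s₁, hs₁, hs01⟩,
      ⟨t₀, (mem t₀).2 (Or.inr ht₀), fun q => ST t₀ q t₀ ht₀ rfl⟩, ?_⟩
    intro u hu hu' x hx y hy
    have hu'' := ((mem u).1 hu).resolve_left hu'
    exact ⟨h1 u hu'' x hx y hy, h2 u hu'' x hx y hy⟩
  have fin : (BaseCut (W.erase m) (normEntry a m) ∨ ∀ v ∈ W.erase m, ∀ x ∈ W.erase m,
      ∀ y ∈ W.erase m, triSign a b m v x ≠ 0 → triSign a b m v y ≠ 0 →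
      triSign a b m v x = triSign a b m v y) → HasCut a W ∨ ∀ v ∈ W, ∀ x ∈ W, ∀ y ∈ W,
      triSign a b m v x ≠ 0 → triSign a b m v y ≠ 0 →
      triSign a b m v x = triSign a b m v y := by
    rintro (q | q)
    · exact Or.inl (h.hasCut_of_baseCut hm q)
    · right
      have nm : ∀ u v, triSign a b m u v ≠ 0 → u ≠ m ∧ v ≠ m := by
        intro u v n
        constructor
        · rintro rfl
          apply n
          rw [← triSign_rotate, triSign_eq_zero_iff]; simp only [cyc]; ring
        · rintro rfl
          apply n
          rw [triSign_eq_zero_iff]; simp only [cyc]; ring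
      intro v hv x hx y hy n1 n2
      exact q v (Finset.mem_erase.2 ⟨(nm _ _ n1).1, hv⟩) x (Finset.mem_erase.2 ⟨(nm _ _ n1).2, hx⟩)
        y (Finset.mem_erase.2 ⟨(nm _ _ n2).2, hy⟩) n1 n2
  rcases out with out | out <;> rcases back with back | back
  · have star : IsStar (W.erase m) (normEntry a m) (· ∈ S) (· ∈ T)
        (fun s => normEntry a m s t₀) (fun t => normEntry a m t s₀) :=
      ⟨mem, fun v hv hv' => ST v hv v hv' rfl, fun s t hs ht => out s hs t ht t₀ ht₀,
        fun s t hs ht => back t ht s hs s₀ hs₀⟩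
    by_cases hα : ∃ s, s ∈ S ∧ ∃ s', s' ∈ S ∧ normEntry a m s t₀ ≠ normEntry a m s' t₀
    · by_cases hβ : ∃ t, t ∈ T ∧ ∃ t', t' ∈ T ∧ normEntry a m t s₀ ≠ normEntry a m t' s₀
      · exact fin (star.baseCut_or_mono hcol hα hβ)
      · push Not at hβ
        refine Or.inl (cutT out fun s hs t ht t' ht' => ?_)
        rw [back t ht s hs s₀ hs₀, back t' ht' s hs s₀ hs₀, hβ t ht t' ht']
    · push Not at hα
      refine Or.inl (cutS back fun t ht s hs s' hs' => ?_)
      rw [out s hs t ht t₀ ht₀, out s' hs' t ht t₀ ht₀, hα s hs s' hs']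
  · exact Or.inl (cutT out back)
  · exact Or.inl (cutS back out)
  · have star : IsStar (W.erase m) (fun i j => normEntry a m j i) (· ∈ S) (· ∈ T)
        (fun s => normEntry a m t₀ s) (fun t => normEntry a m s₀ t) :=
      ⟨mem, fun v hv hv' => ST v hv v hv' rfl, fun s t hs ht => back s hs t ht t₀ ht₀,
        fun s t hs ht => out t ht s hs s₀ hs₀⟩
    by_cases hα : ∃ s, s ∈ S ∧ ∃ s', s' ∈ S ∧ normEntry a m t₀ s ≠ normEntry a m t₀ s'
    · by_cases hβ : ∃ t, t ∈ T ∧ ∃ t', t' ∈ T ∧ normEntry a m s₀ t ≠ normEntry a m s₀ t'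
      · exact fin ((star.baseCut_or_mono hcol.transpose hα hβ).imp_left BaseCut.transpose)
      · push Not at hβ
        refine Or.inl (cutT (fun s hs t ht t' ht' => ?_) back)
        rw [out t ht s hs s₀ hs₀, out t' ht' s hs s₀ hs₀, hβ t ht t' ht']
    · push Not at hα
      refine Or.inl (cutS (fun t ht s hs s' hs' => ?_) out)
      rw [back s hs t ht t₀ ht₀, back s' hs' t ht t₀ ht₀, hα s hs s' hs']

/-- `tri` provides a vertex among `x, y, z` that sees the other two alike; those two form one side.
This is the base of the induction on index sets. -/
theorem MinorData.hasCut_quad (h : MinorData a b) {m x y z : V}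
    (h1 : triSign a b m x y ≠ 0) (h2 : triSign a b m x z ≠ 0)
    (h3 : triSign a b m x y ≠ triSign a b m x z) : HasCut a {m, x, y, z} := by
  have nm : ∀ u v, triSign a b m u v ≠ 0 → u ≠ m ∧ v ≠ m ∧ u ≠ v := by
    intro u v n
    refine ⟨?_, ?_, ?_⟩
    · rintro rfl
      apply n
      rw [← triSign_rotate, triSign_eq_zero_iff]; simp only [cyc]; ring
    · rintro rfl
      apply n
      rw [triSign_eq_zero_iff]; simp only [cyc]; ring
    · rintro rfl
      exact n (triSign_self a b m u)
  obtain ⟨xm, ym, xy⟩ := nm _ _ h1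
  obtain ⟨-, zm, xz⟩ := nm _ _ h2
  have yz : y ≠ z := by rintro rfl; exact h3 rfl
  have he : ({m, x, y, z} : Finset V).erase m = {x, y, z} := by
    ext v; simp only [Finset.mem_erase, Finset.mem_insert, Finset.mem_singleton]; grind
  refine h.hasCut_of_baseCut (m := m) (by simp) ?_
  rw [he]
  have hcol := h.isColored (U := {x, y, z}) (m := m) (by simp; grind)
  rcases hcol.tri x (by simp) y (by simp) z (by simp) h1 h2 h3 with ⟨-, e1, e2⟩ | ⟨-, e1, e2⟩
  · refine ⟨{x, z}, by grind, ⟨x, by simp, z, by simp, xz⟩, ⟨y, by simp, by grind⟩, ?_⟩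
    intro u hu hu' p hp q hq
    simp only [Finset.mem_insert, Finset.mem_singleton] at hu hu' hp hq
    grind
  · refine ⟨{x, y}, by grind, ⟨x, by simp, y, by simp, xy⟩, ⟨z, by simp, by grind⟩, ?_⟩
    intro u hu hu' p hp q hq
    simp only [Finset.mem_insert, Finset.mem_singleton] at hu hu' hp hq
    grind

/-- Two different nonzero signs on an edge `m x` obstruct coherence of every set containing the four
indices. So any further index can be deleted, and the cut found by induction is extended back to it.
-/
theorem MinorData.coherent_or_hasCut (h : MinorData a b) (W : Finset V) :
    Coherent a b W ∨ HasCut a W := by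
  induction W using Finset.strongInduction with
  | H W ih =>
    rcases W.eq_empty_or_nonempty with rfl | ⟨m, hm⟩
    · left; left; simp
    by_cases hmono : ∀ v ∈ W, ∀ x ∈ W, ∀ y ∈ W, triSign a b m v x ≠ 0 →
      triSign a b m v y ≠ 0 → triSign a b m v x = triSign a b m v y
    · exact h.coherent_or_hasCut_of_mono hmono
    push Not at hmono
    obtain ⟨x, hx, y, hy, z, hz, h1, h2, h3⟩ := hmono
    by_cases hW : ∃ m' ∈ W, m' ≠ m ∧ m' ≠ x ∧ m' ≠ y ∧ m' ≠ z
    · obtain ⟨m', hm', n1, n2, n3, n4⟩ := hW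
      have nc : ¬ Coherent a b (W.erase m') := by
        have hm1 := Finset.mem_erase.2 ⟨n1.symm, hm⟩
        have hx1 := Finset.mem_erase.2 ⟨n2.symm, hx⟩
        have hy1 := Finset.mem_erase.2 ⟨n3.symm, hy⟩
        have hz1 := Finset.mem_erase.2 ⟨n4.symm, hz⟩
        have key : ∀ c d : SignType, c ≠ 0 → d ≠ 0 → c ≠ d →
            (c = 1 ∧ d = -1) ∨ (c = -1 ∧ d = 1) := by decide
        rintro (q | q)
        · have q1 := q m hm1 x hx1 y hy1
          have q2 := q m hm1 x hx1 z hz1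
          rcases key _ _ h1 h2 h3 with k | k
          · exact q2 k.2
          · exact q1 k.1
        · have q1 := q m hm1 x hx1 y hy1
          have q2 := q m hm1 x hx1 z hz1
          rcases key _ _ h1 h2 h3 with k | k
          · exact q1 k.1
          · exact q2 k.2
      have hcut := (ih (W.erase m') (Finset.erase_ssubset hm')).resolve_left nc
      rcases h.hasCut_or_mono_of_erase hm' hcut with q | q
      · exact Or.inr q
      · exact h.coherent_or_hasCut_of_mono q
    · right
      push Not at hW
      have : W = {m, x, y, z} := by
        ext v
        simp only [Finset.mem_insert, Finset.mem_singleton]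
        constructor
        · intro hv
          by_contra hh
          push Not at hh
          exact hh.2.2.2 (hW v hv hh.1 hh.2.1 hh.2.2.1)
        · rintro (rfl | rfl | rfl | rfl) <;> assumption
      rw [this]
      exact h.hasCut_quad h1 h2 h3

end Cuts

end PrincipalMinors

namespace PrincipalMinors

/-! ### Determinant of a block matrix with rank-one off-diagonal blocks. -/

section Determinants

open Matrix Polynomial

variable {m n : Type*} [Fintype m] [DecidableEq m] [Fintype n] [DecidableEq n]

/-- The Schur complement of `P` is a rank-one update of `Q`, so the matrix determinant lemma
applies. -/
theorem det_fromBlocks_vecMulVec_of_isUnit {R : Type*} [CommRing R] (P : Matrix m m R)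
    (Q : Matrix n n R) (u y : m → R) (v x : n → R) (hP : IsUnit P.det) (hQ : IsUnit Q.det) :
    (fromBlocks P (vecMulVec u v) (vecMulVec x y) Q).det =
      P.det * Q.det - (y ⬝ᵥ P.adjugate *ᵥ u) * (v ⬝ᵥ Q.adjugate *ᵥ x) := by
  let := P.invertibleOfIsUnitDet hP
  have e1 : Q - vecMulVec x y * ⅟P * vecMulVec u v =
      Q + replicateCol Unit (-(y ⬝ᵥ ⅟P *ᵥ u) • x) * replicateRow Unit v := by
    rw [sub_eq_add_neg]
    congr 1
    rw [← vecMulVec_eq Unit, vecMulVec_mul, vecMulVec_mul_vecMulVec, ← dotProduct_mulVec]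
    ext i j
    simp [vecMulVec_apply]
    ring
  have e2 : (1 + replicateRow Unit v * Q⁻¹ * replicateCol Unit (-(y ⬝ᵥ ⅟P *ᵥ u) • x)).det =
      1 - (y ⬝ᵥ ⅟P *ᵥ u) * (v ⬝ᵥ Q⁻¹ *ᵥ x) := by
    rw [det_unique, Matrix.mul_assoc, ← replicateCol_mulVec]
    rw [Matrix.add_apply, replicateRow_mul_replicateCol_apply, mulVec_smul, dotProduct_smul]
    simp
    ring
  have e3 : P.adjugate = P.det • ⅟P := by
    rw [invOf_eq_nonsing_inv, inv_def, smul_smul, Ring.mul_inverse_cancel _ hP, one_smul]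
  have e4 : Q.adjugate = Q.det • Q⁻¹ := by
    rw [inv_def, smul_smul, Ring.mul_inverse_cancel _ hQ, one_smul]
  rw [det_fromBlocks₁₁, e1, det_add_replicateCol_mul_replicateRow hQ, e2, e3, e4, smul_mulVec,
    smul_mulVec, dotProduct_smul, dotProduct_smul]
  simp only [smul_eq_mul]
  ring

theorem _root_.RingHom.map_det_fromBlocks_vecMulVec {R R' : Type*} [CommRing R] [CommRing R']
    (f : R →+* R') (P : Matrix m m R) (Q : Matrix n n R) (u y : m → R) (v x : n → R) :
    f (fromBlocks P (vecMulVec u v) (vecMulVec x y) Q).det =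
      (fromBlocks (f.mapMatrix P) (vecMulVec (f ∘ u) (f ∘ v)) (vecMulVec (f ∘ x) (f ∘ y))
        (f.mapMatrix Q)).det := by
  rw [f.map_det]
  congr 1
  ext (i | i) (j | j) <;> simp [vecMulVec_apply]

theorem _root_.RingHom.map_dotProduct_adjugate {R R' : Type*} [CommRing R] [CommRing R']
    (f : R →+* R') (P : Matrix m m R) (u y : m → R) :
    f (y ⬝ᵥ P.adjugate *ᵥ u) = (f ∘ y) ⬝ᵥ (f.mapMatrix P).adjugate *ᵥ (f ∘ u) := by
  rw [RingHom.map_dotProduct, ← f.map_adjugate]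
  congr 1
  ext i
  simp [RingHom.map_mulVec]

theorem det_fromBlocks_vecMulVec {K : Type*} [Field K] (P : Matrix m m K)
    (Q : Matrix n n K) (u y : m → K) (v x : n → K) :
    (fromBlocks P (vecMulVec u v) (vecMulVec x y) Q).det =
      P.det * Q.det - (y ⬝ᵥ P.adjugate *ᵥ u) * (v ⬝ᵥ Q.adjugate *ᵥ x) := by
  -- This is `X + P`. Its determinant is monic, hence a unit in the fraction field of `K[X]`; the
  -- identity holds there and specialises at `X = 0`.
  let P' := charmatrix (-P)
  let Q' := charmatrix (-Q)
  have hP : P'.det ≠ 0 := (charpoly_monic (-P)).ne_zero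
  have hQ : Q'.det ≠ 0 := (charpoly_monic (-Q)).ne_zero
  have hpoly : (fromBlocks P' (vecMulVec (C ∘ u) (C ∘ v)) (vecMulVec (C ∘ x) (C ∘ y)) Q').det =
      P'.det * Q'.det - ((C ∘ y) ⬝ᵥ P'.adjugate *ᵥ (C ∘ u)) *
        ((C ∘ v) ⬝ᵥ Q'.adjugate *ᵥ (C ∘ x)) := by
    let f := algebraMap K[X] (FractionRing K[X])
    have hf : Function.Injective f := IsFractionRing.injective _ _
    apply hf
    rw [f.map_det_fromBlocks_vecMulVec, map_sub, map_mul, map_mul, f.map_dotProduct_adjugate,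
      f.map_dotProduct_adjugate, f.map_det, f.map_det]
    apply det_fromBlocks_vecMulVec_of_isUnit
    · rw [← f.map_det]; exact ((map_ne_zero_iff f hf).2 hP).isUnit
    · rw [← f.map_det]; exact ((map_ne_zero_iff f hf).2 hQ).isUnit
  have ev := congrArg (evalRingHom (0 : K)) hpoly
  rw [RingHom.map_det_fromBlocks_vecMulVec, map_sub, map_mul, map_mul,
    RingHom.map_dotProduct_adjugate, RingHom.map_dotProduct_adjugate, RingHom.map_det,
    RingHom.map_det] at ev
  have hm : ∀ w : m → K, (evalRingHom (0 : K)) ∘ (C ∘ w) = w := by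
    intro w; ext i; simp
  have hn : ∀ w : n → K, (evalRingHom (0 : K)) ∘ (C ∘ w) = w := by
    intro w; ext i; simp
  have hP' : (evalRingHom (0 : K)).mapMatrix P' = P := by
    ext i j; by_cases h : i = j <;> simp [P', h]
  have hQ' : (evalRingHom (0 : K)).mapMatrix Q' = Q := by
    ext i j; by_cases h : i = j <;> simp [Q', h]
  simpa only [hP', hQ', hm, hn] using ev

end Determinants

/-! ### Principal minors across a cut, and explicit minors of small order. -/

section Minors

variable {V F : Type*} [Field F] [DecidableEq V]

/-- The principal minor of `a` on `W`. -/
def minor (a : V → V → F) (W : Finset V) : F :=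
  (Matrix.of fun i j : W => a i j).det

open Matrix in
theorem minor_union {a : V → V → F} {S T : Finset V} (h : Disjoint S T) {u y v x : V → F}
    (h1 : ∀ i ∈ S, ∀ k ∈ T, a i k = u i * v k) (h2 : ∀ i ∈ S, ∀ k ∈ T, a k i = x k * y i) :
    minor a (S ∪ T) = minor a S * minor a T -
      ((fun i : S => y i) ⬝ᵥ (Matrix.of fun i j : S => a i j).adjugate *ᵥ (fun i : S => u i)) *
      ((fun i : T => v i) ⬝ᵥ (Matrix.of fun i j : T => a i j).adjugate *ᵥ (fun i : T => x i)) := by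
  rw [minor, ← Matrix.det_submatrix_equiv_self (Equiv.Finset.union S T h)]
  have : (Matrix.of fun i j : ↥(S ∪ T) => a i j).submatrix (Equiv.Finset.union S T h)
      (Equiv.Finset.union S T h) = fromBlocks (Matrix.of fun i j : S => a i j)
        (vecMulVec (fun i : S => u i) (fun i : T => v i))
        (vecMulVec (fun i : T => x i) (fun i : S => y i)) (Matrix.of fun i j : T => a i j) := by
    ext (i | i) (j | j)
    · rfl
    · exact h1 i i.2 j j.2
    · exact h2 j j.2 i i.2
    · rfl
  rw [this, det_fromBlocks_vecMulVec]
  rfl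

omit [DecidableEq V] in
theorem exists_factor {a : V → V → F} {S T : Finset V} {s t : V} (hs : s ∈ S) (ht : t ∈ T)
    (hst : a s t ≠ 0) (h : ∀ i ∈ S, ∀ j ∈ S, ∀ k ∈ T, ∀ l ∈ T, Par a i j k l) :
    ∀ i ∈ S, ∀ k ∈ T, a i k = (a i t / a s t) * a s k := by
  intro i hi k hk
  have := h i hi s hs k hk t ht
  rw [Par] at this
  field_simp
  linear_combination this

theorem minor_singleton (a : V → V → F) (t : V) : minor a {t} = a t t := by
  have : Unique ({t} : Finset V) := ⟨⟨⟨t, by simp⟩⟩, fun ⟨x, hx⟩ => by simpa using hx⟩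
  rw [minor, Matrix.det_unique]
  have : (default : ({t} : Finset V)).1 = t :=
    Finset.mem_singleton.1 (default : ({t} : Finset V)).2
  simp [this]

open Matrix in
/-- Across a two-sided rank-one cut `S | T`, the principal minor on `S ∪ T` is determined by those
on `S`, `T`, `S ∪ {t}` and `{s} ∪ T`. -/
theorem minor_union_formula {a : V → V → F} {S T : Finset V} (h : Disjoint S T) {s t : V}
    (hs : s ∈ S) (ht : t ∈ T) (hst : a s t ≠ 0) (hts : a t s ≠ 0)
    (hcut : ∀ i ∈ S, ∀ j ∈ S, ∀ k ∈ T, ∀ l ∈ T, Par a i j k l ∧ Par a k l i j) :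
    minor a (S ∪ T) * (a s t * a t s) = minor a S * minor a T * (a s t * a t s) -
      (minor a S * a t t - minor a (S ∪ {t})) * (a s s * minor a T - minor a ({s} ∪ T)) := by
  have f1 := exists_factor hs ht hst fun i hi j hj k hk l hl => (hcut i hi j hj k hk l hl).1
  have f2 := exists_factor ht hs hts fun k hk l hl i hi j hj => (hcut i hi j hj k hk l hl).2
  set u : V → F := fun i => a i t / a s t with hu
  set v : V → F := fun k => a s k with hv
  set x : V → F := fun k => a k s / a t s with hx
  set y : V → F := fun i => a t i with hy
  have e := minor_union h (u := u) (v := v) (x := x) (y := y) f1 (fun i hi k hk => f2 k hk i hi)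
  have hS : Disjoint S {t} := by
    rw [Finset.disjoint_singleton_right]
    exact fun q => Finset.disjoint_left.1 h q ht
  have hT : Disjoint {s} T := by
    rw [Finset.disjoint_singleton_left]
    exact fun q => Finset.disjoint_left.1 h hs q
  have eS := minor_union hS (u := u) (v := v) (x := x) (y := y)
    (fun i hi k hk => f1 i hi k (by rw [Finset.mem_singleton.1 hk]; exact ht))
    (fun i hi k hk => f2 k (by rw [Finset.mem_singleton.1 hk]; exact ht) i hi)
  have eT := minor_union hT (u := u) (v := v) (x := x) (y := y)
    (fun i hi k hk => f1 i (by rw [Finset.mem_singleton.1 hi]; exact hs) k hk)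
    (fun i hi k hk => f2 k hk i (by rw [Finset.mem_singleton.1 hi]; exact hs))
  have one : ∀ (z : V) (p q : V → F), ((fun i : ({z} : Finset V) => p i) ⬝ᵥ
      (Matrix.of fun i j : ({z} : Finset V) => a i j).adjugate *ᵥ
        (fun i : ({z} : Finset V) => q i)) = p z * q z := by
    intro z p q
    have : Subsingleton ({z} : Finset V) :=
      ⟨fun ⟨x, hx⟩ ⟨y, hy⟩ => by simp at hx hy; simp [hx, hy]⟩
    rw [adjugate_subsingleton, one_mulVec, dotProduct]
    rw [Finset.sum_coe_sort ({z} : Finset V) (fun i => p i * q i), Finset.sum_singleton]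
  rw [one, minor_singleton] at eS eT
  -- With `u s = x t = 1`, the minors on `S ∪ {t}` and `{s} ∪ T` determine `κ * a s t` and `l * a t
  -- s`, which is all that enters the minor on `S ∪ T`.
  generalize ((fun i : S => y i) ⬝ᵥ (Matrix.of fun i j : S => a i j).adjugate *ᵥ
    (fun i : S => u i)) = κ at *
  generalize ((fun i : T => v i) ⬝ᵥ (Matrix.of fun i j : T => a i j).adjugate *ᵥ
    (fun i : T => x i)) = l at *
  have hut : u s = 1 := div_self hst
  have hxt : x t = 1 := div_self hts
  rw [hxt] at eS
  rw [hut] at eT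
  have hvt : v t = a s t := rfl
  have hys : y s = a t s := rfl
  rw [hvt] at eS
  rw [hys] at eT
  rw [e, eS, eT]
  ring

theorem minor_eq_of_cut {a b : V → V → F} {S T : Finset V} (h : Disjoint S T) {s t : V}
    (hs : s ∈ S) (ht : t ∈ T) (hst : a s t ≠ 0) (hts : a t s ≠ 0)
    (hab : a s t * a t s = b s t * b t s) (hss : a s s = b s s) (htt : a t t = b t t)
    (hcut : ∀ i ∈ S, ∀ j ∈ S, ∀ k ∈ T, ∀ l ∈ T, Par a i j k l ∧ Par a k l i j)
    (hcut' : ∀ i ∈ S, ∀ j ∈ S, ∀ k ∈ T, ∀ l ∈ T, Par b i j k l ∧ Par b k l i j)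
    (h1 : minor a S = minor b S) (h2 : minor a T = minor b T)
    (h3 : minor a (S ∪ {t}) = minor b (S ∪ {t})) (h4 : minor a ({s} ∪ T) = minor b ({s} ∪ T)) :
    minor a (S ∪ T) = minor b (S ∪ T) := by
  have n : a s t * a t s ≠ 0 := mul_ne_zero hst hts
  have n' : b s t * b t s ≠ 0 := hab ▸ n
  have e := minor_union_formula h hs ht hst hts hcut
  have e' := minor_union_formula h hs ht (left_ne_zero_of_mul n') (right_ne_zero_of_mul n') hcut'
  rw [← hab, ← hss, ← htt, ← h1, ← h2, ← h3, ← h4, ← e] at e'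
  exact (mul_right_cancel₀ n e').symm

theorem minor_congr {a b : V → V → F} {W : Finset V} (h : ∀ i ∈ W, ∀ j ∈ W, a i j = b i j) :
    minor a W = minor b W := by
  rw [minor, minor]
  congr 1
  ext i j
  exact h i i.2 j j.2

theorem minor_transpose (a : V → V → F) (W : Finset V) :
    minor (fun i j => a j i) W = minor a W := by
  rw [minor, minor, ← Matrix.det_transpose]
  rfl

theorem minor_eq_of_diagonal {a b : V → V → F} {W : Finset V} (d : V → F)
    (hd : ∀ i ∈ W, d i ≠ 0) (h : ∀ i ∈ W, ∀ j ∈ W, b i j * d j = d i * a i j) :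
    minor a W = minor b W := by
  have e : (Matrix.of fun i j : W => b i j) * Matrix.diagonal (fun i : W => d i) =
      Matrix.diagonal (fun i : W => d i) * (Matrix.of fun i j : W => a i j) := by
    ext i j
    rw [Matrix.mul_diagonal, Matrix.diagonal_mul]
    exact h i i.2 j j.2
  have e' := congrArg Matrix.det e
  rw [Matrix.det_mul, Matrix.det_mul, Matrix.det_diagonal, mul_comm] at e'
  exact (mul_left_cancel₀ (Finset.prod_ne_zero_iff.2 fun (i : W) _ => hd i i.2) e').symm

/-- The principal minor on the indices listed by an injective map. -/
theorem minor_image {k : ℕ} (a : V → V → F) (f : Fin k → V) (hf : Function.Injective f) :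
    minor a (Finset.univ.image f) = (Matrix.of fun i j => a (f i) (f j)).det := by
  let e : Fin k ≃ ↥(Finset.univ.image f) :=
    Equiv.ofBijective (fun i => ⟨f i, Finset.mem_image_of_mem f (Finset.mem_univ i)⟩)
      ⟨fun i j hij => hf (Subtype.ext_iff.1 hij), fun ⟨x, hx⟩ => by
        obtain ⟨i, -, rfl⟩ := Finset.mem_image.1 hx; exact ⟨i, rfl⟩⟩
  rw [minor, ← Matrix.det_submatrix_equiv_self e]
  rfl

theorem minor_pair (a : V → V → F) {i j : V} (h : i ≠ j) :
    minor a {i, j} = a i i * a j j - a i j * a j i := by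
  have := minor_image a ![i, j] (by
    intro x y; fin_cases x <;> fin_cases y <;> simp [h, h.symm])
  rw [Matrix.det_fin_two] at this
  simpa [Finset.image_insert, Fin.univ_succ] using this

theorem minor_triple (a : V → V → F) {i j k : V} (hij : i ≠ j) (hik : i ≠ k) (hjk : j ≠ k) :
    minor a {i, j, k} = a i i * a j j * a k k - a i i * (a j k * a k j) -
      a j j * (a i k * a k i) - a k k * (a i j * a j i) + (cyc a i j k + cyc a i k j) := by
  have := minor_image a ![i, j, k] (by
    intro x y; fin_cases x <;> fin_cases y <;> simp [hij, hik, hjk, hij.symm, hik.symm, hjk.symm])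
  rw [Matrix.det_fin_three] at this
  have hs : Finset.univ.image ![i, j, k] = {i, j, k} := by
    ext x; simp [Fin.exists_fin_succ, eq_comm]
  rw [hs] at this
  rw [this]
  simp [cyc]
  ring

theorem minor_quadruple (a : V → V → F) {i j k l : V} (hij : i ≠ j) (hik : i ≠ k) (hil : i ≠ l)
    (hjk : j ≠ k) (hjl : j ≠ l) (hkl : k ≠ l) :
    minor a {i, j, k, l} = a i i * a j j * a k k * a l l
      - a i i * a j j * (a k l * a l k) - a i i * a k k * (a j l * a l j)
      - a i i * a l l * (a j k * a k j) - a j j * a k k * (a i l * a l i)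
      - a j j * a l l * (a i k * a k i) - a k k * a l l * (a i j * a j i)
      + (a i j * a j i) * (a k l * a l k) + (a i k * a k i) * (a j l * a l j)
      + (a i l * a l i) * (a j k * a k j)
      + a i i * (cyc a j k l + cyc a j l k) + a j j * (cyc a i k l + cyc a i l k)
      + a k k * (cyc a i j l + cyc a i l j) + a l l * (cyc a i j k + cyc a i k j)
      - (a i j * a j k * a k l * a l i + a i l * a l k * a k j * a j i +
        a i j * a j l * a l k * a k i + a i k * a k l * a l j * a j i +
        a i k * a k j * a j l * a l i + a i l * a l j * a j k * a k i) := by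
  have := minor_image a ![i, j, k, l] (by
    intro x y; fin_cases x <;> fin_cases y <;>
      simp [hij, hik, hil, hjk, hjl, hkl, hij.symm, hik.symm, hil.symm, hjk.symm, hjl.symm,
        hkl.symm])
  have hs : Finset.univ.image ![i, j, k, l] = {i, j, k, l} := by
    ext x; simp [Fin.exists_fin_succ, eq_comm]
  rw [hs] at this
  rw [this, Matrix.det_succ_row_zero]
  simp [Fin.sum_univ_succ, Matrix.det_fin_three, Fin.succAbove, cyc]
  ring

end Minors

end PrincipalMinors

namespace PrincipalMinors

/-! ### Equality of minors for coherent sets and for cuts with a two-element side. -/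

section Equality

variable {V F : Type*} [Field F] [DecidableEq V] {a b : V → V → F}

/-- On `W` the normalised entries of `b` at `m` are those of `a`, or their transposes. Undoing the
normalisation costs a diagonal similarity, because the two-cycles at `m` agree. -/
theorem MinorData.minor_eq_of_coherent (h : MinorData a b) {W : Finset V}
    (hc : Coherent a b W) : minor a W = minor b W := by
  have hb : ∀ i j, i ≠ j → b i j ≠ 0 := fun i j hij => h.dense' hij
  rcases W.eq_empty_or_nonempty with rfl | ⟨m, hm⟩
  · exact minor_congr (by simp)
  rcases hc with hc | hc
  · refine minor_eq_of_diagonal (fun i => if i = m then 1 else b i m / a i m) ?_ ?_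
    · intro i hi
      split_ifs with q
      · exact one_ne_zero
      · exact div_ne_zero (hb i m q) (h.dense i m q)
    · intro i hi j hj
      by_cases hij : i = j
      · subst hij; rw [h.diag]; ring
      by_cases him : i = m
      · subst him
        have := h.dense j i (Ne.symm hij)
        have e := h.two i j
        simp only [if_true, if_neg (Ne.symm hij)]
        field_simp
        linear_combination -e
      by_cases hjm : j = m
      · subst hjm
        have := h.dense i j hij
        simp only [if_true, if_neg hij]
        field_simp
      · have n1 := h.dense i m him
        have n2 := h.dense j m hjm
        have e := (h.normEntry_or him hjm).2.1.1 (hc m hm i hi j hj)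
        simp only [if_neg him, if_neg hjm]
        rw [normEntry_mul hb him hjm, e, normEntry_mul h.dense him hjm]
        field_simp
        have e2 := h.two m j
        linear_combination -normEntry a m i j * b i m * e2
  · rw [← minor_transpose a]
    refine minor_eq_of_diagonal (fun i => if i = m then 1 else b i m / a m i) ?_ ?_
    · intro i hi
      split_ifs with q
      · exact one_ne_zero
      · exact div_ne_zero (hb i m q) (h.dense m i (Ne.symm q))
    · intro i hi j hj
      by_cases hij : i = j
      · subst hij; rw [h.diag]; ring
      by_cases him : i = m
      · subst him
        have := h.dense i j hij
        have e := h.two i j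
        simp only [if_true, if_neg (Ne.symm hij)]
        field_simp
        linear_combination -e
      by_cases hjm : j = m
      · subst hjm
        have := h.dense j i (Ne.symm hij)
        simp only [if_true, if_neg hij]
        field_simp
      · have n1 := h.dense m i (Ne.symm him)
        have n2 := h.dense m j (Ne.symm hjm)
        have e := (h.normEntry_or him hjm).2.2.1 (hc m hm i hi j hj)
        simp only [if_neg him, if_neg hjm]
        rw [normEntry_mul hb him hjm, e, normEntry_mul h.dense hjm him]
        field_simp
        have e2 := h.two m j
        linear_combination -normEntry a m j i * b i m * e2

/-- With base `i`, the two conditions say that `k` and `l` have equal normalised entries towards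
`j`, in each direction. Equal signs mean that `b` copies both or transposes both. -/
theorem MinorData.par_of_triSign_eq (h : MinorData a b) {i j k l : V} (hik : i ≠ k) (hil : i ≠ l)
    (h1 : Par a i j k l) (h2 : Par a k l i j)
    (hc : triSign a b i j k = triSign a b i j l) : Par b i j k l ∧ Par b k l i j := by
  have hb : ∀ i j, i ≠ j → b i j ≠ 0 := fun i j hij => h.dense' hij
  by_cases hij : j = i
  · subst hij
    exact ⟨by simp only [Par]; ring, by simp only [Par]⟩
  rw [par_row_iff h.dense hij hik.symm hil.symm] at h1
  rw [par_col_iff h.dense hij hik.symm hil.symm] at h2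
  rw [par_row_iff hb hij hik.symm hil.symm, par_col_iff hb hij hik.symm hil.symm]
  by_cases q : triSign a b i j k = -1
  · have q1 : triSign a b i j k ≠ 1 := by rw [q]; decide
    have q2 : triSign a b i j l ≠ 1 := hc ▸ q1
    have q3 : triSign a b i k j ≠ 1 := by rwa [h.triSign_swap]
    have q4 : triSign a b i l j ≠ 1 := by rwa [h.triSign_swap]
    rw [(h.normEntry_or hij hik.symm).2.2.1 q1, (h.normEntry_or hij hil.symm).2.2.1 q2,
      (h.normEntry_or hik.symm hij).2.2.1 q3, (h.normEntry_or hil.symm hij).2.2.1 q4]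
    exact ⟨h2, h1⟩
  · have q2 : triSign a b i j l ≠ -1 := hc ▸ q
    have q3 : triSign a b i k j ≠ -1 := by rwa [h.triSign_swap]
    have q4 : triSign a b i l j ≠ -1 := by rwa [h.triSign_swap]
    rw [(h.normEntry_or hij hik.symm).2.1.1 q, (h.normEntry_or hij hil.symm).2.1.1 q2,
      (h.normEntry_or hik.symm hij).2.1.1 q3, (h.normEntry_or hil.symm hij).2.1.1 q4]
    exact ⟨h1, h2⟩

/-- The case of a cut `{s, s'} | T` of `a` that `b` does not share: then `b` has a cut around a
part `X` of `T`, and an intermediate matrix shares one cut with `a` and the other with `b`. -/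
theorem MinorData.minor_eq_of_twins (h : MinorData a b) {T X Z : Finset V} {s s' : V} (hss : s ≠ s')
    (hs : s ∉ T) (hs' : s' ∉ T) (hXZ : Disjoint X Z) (hT : X ∪ Z = T)
    (hX : ∃ x ∈ X, ∃ y ∈ X, x ≠ y) (hZ : Z.Nonempty)
    (hcut : ∀ i ∈ ({s, s'} : Finset V), ∀ j ∈ ({s, s'} : Finset V), ∀ k ∈ T, ∀ l ∈ T,
      Par a i j k l ∧ Par a k l i j) {p q : F}
    (f1 : ∀ x ∈ X, normEntry b s s' x = p ∧ normEntry b s x s' = q)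
    (f2 : ∀ z ∈ Z, normEntry b s s' z = q ∧ normEntry b s z s' = p)
    (f3 : ∀ x ∈ X, ∀ z ∈ Z, normEntry b s x z = q ∧ normEntry b s z x = p)
    (ih : ∀ W ⊂ {s, s'} ∪ T, minor a W = minor b W) :
    minor a ({s, s'} ∪ T) = minor b ({s, s'} ∪ T) := by
  have hb : ∀ i j, i ≠ j → b i j ≠ 0 := fun i j hij => h.dense' hij
  have XT : ∀ x ∈ X, x ∈ T := fun x hx => hT ▸ Finset.mem_union_left _ hx
  have ZT : ∀ x ∈ Z, x ∈ T := fun x hx => hT ▸ Finset.mem_union_right _ hx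
  have Ts : ∀ t ∈ T, t ≠ s := fun t ht => ne_of_mem_of_not_mem ht hs
  have Ts' : ∀ t ∈ T, t ≠ s' := fun t ht => ne_of_mem_of_not_mem ht hs'
  -- The entries of `c` between `s'` and `T`, normalised at `s`, are `p` and `q` throughout, so `c`
  -- has the cut `{s, s'} | T`. It differs from `b` at most between `s'` and `Z`, where `p` and `q`
  -- are interchanged.
  let c : V → V → F := fun j k => if j = s' ∧ k ∈ T then p * (b s' s * b s k) else
    if k = s' ∧ j ∈ T then q * (b j s * b s s') else b j k
  have c1 : ∀ t ∈ T, c s' t = p * (b s' s * b s t) := fun t ht => by simp [c, ht]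
  have c2 : ∀ t ∈ T, c t s' = q * (b t s * b s s') := fun t ht => by simp [c, ht, hs']
  have c3 : ∀ j k, (j = s' → k ∉ T) → (k = s' → j ∉ T) → c j k = b j k := by
    intro j k h1 h2
    have h1' : ¬ (j = s' ∧ k ∈ T) := fun e => h1 e.1 e.2
    have h2' : ¬ (k = s' ∧ j ∈ T) := fun e => h2 e.1 e.2
    simp [c, h1', h2']
  have c4 : ∀ j ≠ s', ∀ k ≠ s', c j k = b j k := fun j hj k hk =>
    c3 j k (fun e => absurd e hj) (fun e => absurd e hk)
  have c5 : ∀ x ∈ X, c s' x = b s' x ∧ c x s' = b x s' := by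
    intro x hx
    have f := f1 x hx
    rw [c1 x (XT x hx), c2 x (XT x hx), normEntry_mul hb hss.symm (Ts x (XT x hx)),
      normEntry_mul hb (Ts x (XT x hx)) hss.symm, f.1, f.2]
    exact ⟨rfl, rfl⟩
  have cs : ∀ i, c s i = b s i ∧ c i s = b i s := fun i =>
    ⟨c3 s i (fun e => absurd e hss) (fun _ => hs), c3 i s (fun _ => hs) (fun e => absurd e hss)⟩
  have cd : ∀ i, c i i = b i i := fun i => c3 i i (fun e => e ▸ hs') (fun e => e ▸ hs')
  have ccut : ∀ i ∈ ({s, s'} : Finset V), ∀ j ∈ ({s, s'} : Finset V), ∀ k ∈ T, ∀ l ∈ T,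
      Par c i j k l ∧ Par c k l i j := by
    intro i hi j hj k hk l hl
    simp only [Finset.mem_insert, Finset.mem_singleton] at hi hj
    rcases hi with rfl | rfl <;> rcases hj with rfl | rfl <;>
      simp only [Par, c1 k hk, c1 l hl, c2 k hk, c2 l hl, cs] <;> constructor <;> first | trivial | ring
  have ctri : ∀ t ∈ T, minor c ({s, s'} ∪ {t}) = minor b ({s, s'} ∪ {t}) := by
    intro t ht
    have e : ({s, s'} ∪ {t} : Finset V) = {s, s', t} := by
      ext v; simp
    rw [e, minor_triple c hss (Ts t ht).symm (Ts' t ht).symm,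
      minor_triple b hss (Ts t ht).symm (Ts' t ht).symm]
    have e1 := normEntry_mul hb hss.symm (Ts t ht)
    have e2 := normEntry_mul hb (Ts t ht) hss.symm
    simp only [cyc, cd, c1 t ht, c2 t ht, cs]
    rcases Finset.mem_union.1 (hT.symm ▸ ht) with hx | hz
    · rw [e1, e2, (f1 t hx).1, (f1 t hx).2]
    · rw [e1, e2, (f2 t hz).1, (f2 t hz).2]; ring
  have hpair : minor c {s, s'} = minor b {s, s'} := by
    rw [minor_pair c hss, minor_pair b hss, cd, cd, (cs s').1, (cs s').2]
  have cT : ∀ W : Finset V, s' ∉ W → minor c W = minor b W := fun W hW =>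
    minor_congr fun i hi j hj => c4 i (ne_of_mem_of_not_mem hi hW) j (ne_of_mem_of_not_mem hj hW)
  have sub_of : ∀ W ⊆ {s, s'} ∪ T, ∀ v ∈ {s, s'} ∪ T, v ∉ W → W ⊂ {s, s'} ∪ T :=
    fun W h1 v h2 h3 => Finset.ssubset_iff_subset_ne.2 ⟨h1, fun e => h3 (e ▸ h2)⟩
  have ms : s ∈ {s, s'} ∪ T := by simp
  have ms' : s' ∈ {s, s'} ∪ T := by simp
  obtain ⟨x, hx, y, hy, hxy⟩ := hX
  -- the first cut
  have first : ∀ T' ⊆ T, T'.Nonempty → minor a ({s, s'} ∪ T') = minor c ({s, s'} ∪ T') := by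
    rintro T' hT' ⟨t, ht⟩
    have htT := hT' ht
    have sT' : s ∉ T' := fun e => hs (hT' e)
    have s'T' : s' ∉ T' := fun e => hs' (hT' e)
    have d : Disjoint ({s, s'} : Finset V) T' := by
      rw [Finset.disjoint_left]
      intro v hv hv'
      simp only [Finset.mem_insert, Finset.mem_singleton] at hv
      rcases hv with rfl | rfl
      · exact sT' hv'
      · exact s'T' hv'
    have sub1 : ({s} ∪ T' : Finset V) ⊆ {s, s'} ∪ T :=
      Finset.union_subset_union (by simp) hT'
    have nin : s' ∉ ({s} ∪ T' : Finset V) := by simp [hss.symm, s'T']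
    refine minor_eq_of_cut d (s := s) (t := t) (by simp) ht (h.dense s t (Ts t htT).symm)
      (h.dense t s (Ts t htT)) ?_ ?_ ?_
      (fun i hi j hj k hk l hl => hcut i hi j hj k (hT' hk) l (hT' hl))
      (fun i hi j hj k hk l hl => ccut i hi j hj k (hT' hk) l (hT' hl)) ?_ ?_ ?_ ?_
    · rw [(cs t).1, (cs t).2]; exact h.two s t
    · rw [cd]; exact h.diag s
    · rw [cd]; exact h.diag t
    · rw [hpair]
      refine ih _ (sub_of _ Finset.subset_union_left x (Finset.mem_union_right _ (XT x hx)) ?_)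
      simp [Ts x (XT x hx), Ts' x (XT x hx)]
    · rw [cT T' s'T']
      exact ih _ (sub_of _ (hT'.trans Finset.subset_union_right) s' ms' s'T')
    · rw [ctri t htT]
      -- Two elements in `X` make `{s, s'} ∪ {t}` a proper subset, so that `ih` applies.
      obtain ⟨v, hv, hvt⟩ : ∃ v ∈ T, v ≠ t := by
        by_cases e : x = t
        · exact ⟨y, XT y hy, fun e' => hxy (e.trans e'.symm)⟩
        · exact ⟨x, XT x hx, e⟩
      refine ih _ (sub_of _ (Finset.union_subset_union subset_rfl (by simpa using htT)) v
        (Finset.mem_union_right _ hv) ?_)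
      simp [Ts v hv, Ts' v hv, hvt]
    · rw [cT _ nin]
      exact ih _ (sub_of _ sub1 s' ms' nin)
  rw [first T subset_rfl ⟨x, XT x hx⟩]
  -- the second cut
  let ψ : V → F := fun k => if k = s then 1 else q * b s k
  let φ : V → F := fun k => if k = s then 1 else p * b k s
  -- Between `X` and the rest, `b` and `c` coincide, and both blocks factor with `s` as reference
  -- column and row; hence both matrices have this cut.
  have YX : ∀ k ∈ {s, s'} ∪ Z, ∀ i ∈ X, b i k = b i s * ψ k ∧ b k i = φ k * b s i ∧
      c i k = b i k ∧ c k i = b k i := by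
    intro k hk i hi
    have iT := XT i hi
    rcases Finset.mem_union.1 hk with hk | hk
    · simp only [Finset.mem_insert, Finset.mem_singleton] at hk
      rcases hk with rfl | rfl
      · refine ⟨by simp [ψ], by simp [φ], (cs i).2, (cs i).1⟩
      · refine ⟨?_, ?_, (c5 i hi).2, (c5 i hi).1⟩
        · rw [normEntry_mul hb (Ts i iT) hss.symm, (f1 i hi).2]
          simp only [ψ, if_neg hss.symm]; ring
        · rw [normEntry_mul hb hss.symm (Ts i iT), (f1 i hi).1]
          simp only [φ, if_neg hss.symm]; ring
    · have kT := ZT k hk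
      refine ⟨?_, ?_, c4 i (Ts' i iT) k (Ts' k kT), c4 k (Ts' k kT) i (Ts' i iT)⟩
      · rw [normEntry_mul hb (Ts i iT) (Ts k kT), (f3 i hi k hk).1]
        simp only [ψ, if_neg (Ts k kT)]; ring
      · rw [normEntry_mul hb (Ts k kT) (Ts i iT), (f3 i hi k hk).2]
        simp only [φ, if_neg (Ts k kT)]; ring
  have dXY : Disjoint X ({s, s'} ∪ Z) := by
    rw [Finset.disjoint_left]
    intro v hv hv'
    rcases Finset.mem_union.1 hv' with hk | hk
    · simp only [Finset.mem_insert, Finset.mem_singleton] at hk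
      rcases hk with rfl | rfl
      · exact hs (XT _ hv)
      · exact hs' (XT _ hv)
    · exact Finset.disjoint_left.1 hXZ hv hk
  have hW : ({s, s'} ∪ T : Finset V) = X ∪ ({s, s'} ∪ Z) := by
    rw [← hT, Finset.union_left_comm]
  have hsY : s ∈ ({s, s'} ∪ Z : Finset V) := by simp
  have s'X : s' ∉ X := fun e => hs' (XT _ e)
  rw [hW]
  have hx1 : x ≠ s := Ts x (XT x hx)
  refine minor_eq_of_cut dXY (s := x) (t := s) hx hsY ?_ ?_ ?_ (cd x) (cd s) ?_ ?_
    (cT X s'X) ?_ ?_ ?_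
  · rw [(cs x).2]; exact hb x s hx1
  · rw [(cs x).1]; exact hb s x hx1.symm
  · rw [(cs x).1, (cs x).2]
  · intro i hi j hj k hk l hl
    have a1 := YX k hk i hi
    have a2 := YX k hk j hj
    have a3 := YX l hl i hi
    have a4 := YX l hl j hj
    simp only [Par]
    rw [a1.2.2.1, a1.2.2.2, a2.2.2.1, a2.2.2.2, a3.2.2.1, a3.2.2.2, a4.2.2.1, a4.2.2.2, a1.1,
      a1.2.1, a2.1, a2.2.1, a3.1, a3.2.1, a4.1, a4.2.1]
    constructor <;> ring
  · intro i hi j hj k hk l hl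
    have a1 := YX k hk i hi
    have a2 := YX k hk j hj
    have a3 := YX l hl i hi
    have a4 := YX l hl j hj
    simp only [Par]
    rw [a1.1, a1.2.1, a2.1, a2.2.1, a3.1, a3.2.1, a4.1, a4.2.1]
    constructor <;> ring
  · rw [← first Z (fun z hz => ZT z hz) hZ]
    refine ih _ (sub_of _ (Finset.union_subset_union subset_rfl (fun z hz => ZT z hz)) x
      (Finset.mem_union_right _ (XT x hx)) ?_)
    exact Finset.disjoint_left.1 dXY hx
  · refine cT _ ?_
    simp [s'X, hss.symm]
  · have e : ({x} ∪ ({s, s'} ∪ Z) : Finset V) = {s, s'} ∪ ({x} ∪ Z) := Finset.union_left_comm _ _ _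
    have sub2 : ({x} ∪ Z : Finset V) ⊆ T :=
      Finset.union_subset (by simpa using XT x hx) (fun z hz => ZT z hz)
    rw [e, ← first _ sub2 ⟨x, by simp⟩]
    refine ih _ (sub_of _ (Finset.union_subset_union subset_rfl sub2) y
      (Finset.mem_union_right _ (XT y hy)) ?_)
    have hyZ : y ∉ Z := Finset.disjoint_left.1 hXZ hy
    simp [Ts y (XT y hy), Ts' y (XT y hy), hxy.symm, hyZ]

end Equality

end PrincipalMinors

namespace PrincipalMinors

/-! ### The induction over index sets, by a cut with a smallest side. -/

section Final

variable {V F : Type*} [Field F] [DecidableEq V] {a b : V → V → F}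

/-- `S | T` is a partition of `W` into two sets with at least two elements such that both
off-diagonal blocks of `a` have rank one. -/
structure IsCut (a : V → V → F) (W S T : Finset V) : Prop where
  disj : Disjoint S T
  union : S ∪ T = W
  left : ∃ x ∈ S, ∃ y ∈ S, x ≠ y
  right : ∃ x ∈ T, ∃ y ∈ T, x ≠ y
  par : ∀ i ∈ S, ∀ j ∈ S, ∀ k ∈ T, ∀ l ∈ T, Par a i j k l ∧ Par a k l i j

theorem IsCut.symm {W S T : Finset V} (h : IsCut a W S T) : IsCut a W T S where
  disj := h.disj.symm
  union := by rw [Finset.union_comm, h.union]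
  left := h.right
  right := h.left
  par i hi j hj k hk l hl := (h.par k hk l hl i hi j hj).symm

omit [DecidableEq V] in
theorem Par.trans_cols {i j k t l : V} (hi : a i t ≠ 0) (hj : a j t ≠ 0)
    (h1 : Par a i j k t) (h2 : Par a i j t l) : Par a i j k l := by
  simp only [Par] at *
  apply mul_left_cancel₀ (mul_ne_zero hi hj)
  linear_combination (a i t * a j l) * h1 + (a i t * a j k) * h2

omit [DecidableEq V] in
theorem Par.trans_rows {i j k t l : V} (hi : a t i ≠ 0) (hj : a t j ≠ 0)
    (h1 : Par a k t i j) (h2 : Par a t l i j) : Par a k l i j := by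
  simp only [Par] at *
  apply mul_left_cancel₀ (mul_ne_zero hi hj)
  linear_combination (a t i * a l j) * h1 + (a t i * a k j) * h2

/-- A cut of the smaller set `S ∪ {t}` gives a cut of the whole set with a side inside `S`. -/
theorem IsCut.refine (hd : ∀ i j, i ≠ j → a i j ≠ 0) {W S T S₁ T₁ : Finset V} {t : V}
    (h : IsCut a W S T) (ht : t ∈ T) (h1 : IsCut a (insert t S) S₁ T₁) (ht1 : t ∈ T₁) :
    S₁ ⊂ S ∧ IsCut a W S₁ (W \ S₁) := by
  have tS : t ∉ S := fun q => Finset.disjoint_left.1 h.disj q ht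
  have mem1 : ∀ v, v ∈ S₁ ∨ v ∈ T₁ ↔ v = t ∨ v ∈ S := fun v => by
    rw [← Finset.mem_union, h1.union, Finset.mem_insert]
  have memW : ∀ v, v ∈ W ↔ v ∈ S ∨ v ∈ T := fun v => by rw [← Finset.mem_union, h.union]
  have S1S : ∀ v ∈ S₁, v ∈ S := by
    intro v hv
    rcases (mem1 v).1 (Or.inl hv) with rfl | q
    · exact absurd ht1 (Finset.disjoint_left.1 h1.disj hv)
    · exact q
  have S1W : S₁ ⊆ W := fun v hv => (memW v).2 (Or.inl (S1S v hv))
  have TS1 : ∀ v ∈ T, v ∉ S₁ := fun v hv hv' => Finset.disjoint_left.1 h.disj (S1S v hv') hv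
  obtain ⟨w, hwT, hwS, hwt⟩ : ∃ w ∈ T₁, w ∈ S ∧ w ≠ t := by
    obtain ⟨x, hx, y, hy, hxy⟩ := h1.right
    by_cases q : x = t
    · exact ⟨y, hy, ((mem1 y).1 (Or.inr hy)).resolve_left fun e => hxy (q.trans e.symm),
        fun e => hxy (q.trans e.symm)⟩
    · exact ⟨x, hx, ((mem1 x).1 (Or.inr hx)).resolve_left q, q⟩
  have ss : S₁ ⊂ S := Finset.ssubset_iff_subset_ne.2
    ⟨S1S, fun e => Finset.disjoint_left.1 h1.disj (e ▸ hwS) hwT⟩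
  refine ⟨ss, Finset.disjoint_sdiff, Finset.union_sdiff_of_subset S1W, h1.left, ?_, ?_⟩
  · obtain ⟨x, hx, y, hy, hxy⟩ := h.right
    exact ⟨x, Finset.mem_sdiff.2 ⟨(memW x).2 (Or.inr hx), TS1 x hx⟩, y,
      Finset.mem_sdiff.2 ⟨(memW y).2 (Or.inr hy), TS1 y hy⟩, hxy⟩
  · have toT : ∀ k, k ∈ W \ S₁ → k ∈ T ∨ k ∈ T₁ := by
      intro k hk
      have hk' := Finset.mem_sdiff.1 hk
      rcases (memW k).1 hk'.1 with q | q
      · exact Or.inr (((mem1 k).2 (Or.inr q)).resolve_left hk'.2)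
      · exact Or.inl q
    have S1t : ∀ i ∈ S₁, i ≠ t := fun i hi => ne_of_mem_of_not_mem (S1S i hi) tS
    -- The index `t` belongs to both cuts, and being parallel to its row or column is transitive by
    -- density.
    have key : ∀ i ∈ S₁, ∀ j ∈ S₁, ∀ k ∈ W \ S₁, Par a i j k t ∧ Par a k t i j := by
      intro i hi j hj k hk
      rcases toT k hk with q | q
      · exact h.par i (S1S i hi) j (S1S j hj) k q t ht
      · exact h1.par i hi j hj k q t ht1
    intro i hi j hj k hk l hl
    have k1 := key i hi j hj k hk
    have k2 := key i hi j hj l hl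
    exact ⟨k1.1.trans_cols (hd i t (S1t i hi)) (hd j t (S1t j hj)) k2.1.swap_cols,
      k1.2.trans_rows (hd t i (S1t i hi).symm) (hd t j (S1t j hj).symm) k2.2.swap_rows⟩

/-- If `b` keeps the triangle `s₁ s₂ t` and reverses `s₁ s₂ t'` across a minimal side `S` of a cut
of `a`, then `S = {s₁, s₂}`. -/
theorem MinorData.eq_pair_of_minimal (h : MinorData a b) {W S T : Finset V} {s₁ s₂ t t' : V}
    (hc : IsCut a W S T) (hco : Coherent a b (insert t S)) (hno : ¬ HasCut a (insert t S))
    (hs₁ : s₁ ∈ S) (hs₂ : s₂ ∈ S) (ht : t ∈ T) (ht' : t' ∈ T)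
    (c1 : triSign a b s₁ s₂ t = 1) (c2 : triSign a b s₁ s₂ t' = -1) : S = {s₁, s₂} := by
  have ST : ∀ s ∈ S, ∀ t ∈ T, s ≠ t := Finset.disjoint_iff_ne.1 hc.disj
  have tt' : t' ≠ t := by
    rintro rfl; rw [c1] at c2; exact absurd c2 (by decide)
  have s12 : s₂ ≠ s₁ := by
    rintro rfl
    rw [← triSign_rotate, ← triSign_rotate, triSign_self] at c1
    exact absurd c1 (by decide)
  have hco' : ∀ i ∈ insert t S, ∀ j ∈ insert t S, ∀ k ∈ insert t S, triSign a b i j k ≠ -1 :=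
    hco.resolve_right fun q => q s₁ (Finset.mem_insert_of_mem hs₁) s₂
      (Finset.mem_insert_of_mem hs₂) t (Finset.mem_insert_self _ _) c1
  have e : ∀ x ∈ S, ∀ y ∈ S, normEntry a t x t' = normEntry a t y t' ∧
      normEntry a t t' x = normEntry a t t' y := by
    intro x hx y hy
    have p := hc.par x hx y hy t ht t' ht'
    exact ⟨(par_col_iff h.dense tt' (ST x hx t ht) (ST y hy t ht)).1 p.1,
      (par_row_iff h.dense tt' (ST x hx t ht) (ST y hy t ht)).1 p.2⟩
  have nz1 : triSign a b t t' s₁ ≠ 0 := by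
    have T := h.tri (m := s₁) (j := s₂) (k := t) (l := t') s12 (ST s₁ hs₁ t ht).symm
      (ST s₁ hs₁ t' ht').symm c1 c2
    rw [triSign_rotate]
    rcases T with q | q
    · rw [q.1]; decide
    · rw [q.1]; decide
  -- Seen from `t`, all points of `S` have the same entries towards `t'`, so they share the nonzero
  -- colour status of `s₁`.
  have nz : ∀ s ∈ S, triSign a b t t' s ≠ 0 := by
    intro s hs
    rw [Ne, (h.normEntry_or tt' (ST s hs t ht)).1, (e s hs s₁ hs₁).1, (e s hs s₁ hs₁).2,
      ← (h.normEntry_or tt' (ST s₁ hs₁ t ht)).1]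
    exact nz1
  have pm : ∀ c : SignType, c ≠ 0 → c = 1 ∨ c = -1 := by decide
  have k1 : triSign a b t s₁ s₂ = 1 := by
    rwa [← triSign_rotate]
  have k2 : triSign a b t' s₁ s₂ = -1 := by
    rwa [← triSign_rotate]
  have rot : ∀ s, triSign a b t' t s = triSign a b t t' s := fun s => by
    rw [← h.triSign_swap, triSign_rotate]
  -- Equal signs would make all triangles at `t` not reversed, or all at `t'` not kept,
  -- contradicting `c2` or `c1`.
  have hdiff : triSign a b t t' s₁ ≠ triSign a b t t' s₂ := by
    intro q
    rcases pm _ nz1 with q1 | q1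
    · refine h.ne_neg_one_of_base (m := t) (i := s₁) (j := s₂) (k := t') ?_ ?_ ?_ c2
      · rw [k1]; decide
      · rw [h.triSign_swap, ← q, q1]; decide
      · rw [h.triSign_swap, q1]; decide
    · refine h.ne_one_of_base (m := t') (i := s₁) (j := s₂) (k := t) ?_ ?_ ?_ c1
      · rw [k2]; decide
      · rw [h.triSign_swap, rot, ← q, q1]; decide
      · rw [h.triSign_swap, rot, q1]; decide
  -- Coherence of `insert t S` excludes a reversed triangle, so the first alternative of `tri`
  -- holds.
  have link : ∀ x ∈ S, ∀ y ∈ S, triSign a b t t' x = 1 → triSign a b t t' y = -1 →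
      normEntry a t x t' = normEntry a t x y ∧ normEntry a t t' x = normEntry a t y x := by
    intro x hx y hy h1 h2
    rcases h.tri tt' (ST x hx t ht) (ST y hy t ht) h1 h2 with q | q
    · exact q.2
    · exact absurd q.1 (hco' t (Finset.mem_insert_self _ _) x (Finset.mem_insert_of_mem hx) y
        (Finset.mem_insert_of_mem hy))
  have tS : t ∉ S := fun q => ST t q t ht rfl
  -- All entries between the two sign classes of `S` are constant in each direction. A class with
  -- two elements would thus be a side of a cut of `insert t S`, which `hno` forbids; so both
  -- classes are singletons.
  have one : ∀ (δ δ' : SignType), (δ = 1 ∧ δ' = -1) ∨ (δ = -1 ∧ δ' = 1) →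
      (∃ x ∈ S, triSign a b t t' x = δ) → ∀ y ∈ S, ∀ y' ∈ S, triSign a b t t' y = δ' →
      triSign a b t t' y' = δ' → y = y' := by
    rintro δ δ' hδ ⟨x, hx, hxδ⟩ y hy y' hy' hyδ hyδ'
    by_contra hne
    apply hno
    refine h.hasCut_of_baseCut (Finset.mem_insert_self t S) ?_
    rw [Finset.erase_insert tS]
    have hdd : δ ≠ δ' := by rcases hδ with ⟨rfl, rfl⟩ | ⟨rfl, rfl⟩ <;> decide
    refine ⟨S.filter fun v => triSign a b t t' v = δ', Finset.filter_subset _ _,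
      ⟨y, Finset.mem_filter.2 ⟨hy, hyδ⟩, y', Finset.mem_filter.2 ⟨hy', hyδ'⟩, hne⟩,
      ⟨x, hx, fun q => hdd (hxδ.symm.trans (Finset.mem_filter.1 q).2)⟩, ?_⟩
    intro u hu hu' z hz z' hz'
    obtain ⟨hzS, hzδ⟩ := Finset.mem_filter.1 hz
    obtain ⟨hzS', hzδ'⟩ := Finset.mem_filter.1 hz'
    have huδ : triSign a b t t' u ≠ δ' := fun q => hu' (Finset.mem_filter.2 ⟨hu, q⟩)
    have ezz := e z hzS z' hzS'
    rcases hδ with ⟨rfl, rfl⟩ | ⟨rfl, rfl⟩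
    · have u1 := (pm _ (nz u hu)).resolve_right huδ
      have l1 := link u hu z hzS u1 hzδ
      have l2 := link u hu z' hzS' u1 hzδ'
      exact ⟨l1.1.symm.trans l2.1, l1.2.symm.trans l2.2⟩
    · have u1 := (pm _ (nz u hu)).resolve_left huδ
      have l1 := link z hzS u hu hzδ u1
      have l2 := link z' hzS' u hu hzδ' u1
      exact ⟨l1.2.symm.trans (ezz.2.trans l2.2), l1.1.symm.trans (ezz.1.trans l2.1)⟩
  ext s
  simp only [Finset.mem_insert, Finset.mem_singleton]
  refine ⟨fun hs => ?_, by rintro (rfl | rfl) <;> assumption⟩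
  by_cases q : triSign a b t t' s = triSign a b t t' s₁
  · left
    refine one (triSign a b t t' s₂) (triSign a b t t' s₁) ?_ ⟨s₂, hs₂, rfl⟩ s hs s₁ hs₁ q rfl
    have := pm _ (nz s₁ hs₁)
    have := pm _ (nz s₂ hs₂)
    grind
  · right
    have p0 := pm _ (nz s hs)
    have p1 := pm _ (nz s₁ hs₁)
    have p2 := pm _ (nz s₂ hs₂)
    refine one (triSign a b t t' s₁) (triSign a b t t' s₂) ?_ ⟨s₁, hs₁, rfl⟩ s hs s₂ hs₂ ?_ rfl
    · grind
    · grind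

/-- Split `T` into the kept part `X` and the reversed part `Z`. By `tri`, the entries of `b` between
`X` and `Z` are also the two values occurring at `s'`. The roles of `X` and `Z` are symmetric up to
swapping these values, and five indices ensure that one part has two elements. -/
theorem MinorData.minor_eq_of_pair_cut (h : MinorData a b) {T : Finset V} {s s' t t' : V}
    (hc : IsCut a ({s, s'} ∪ T) {s, s'} T) (hss : s ≠ s') (ht : t ∈ T) (ht' : t' ∈ T)
    (c1 : triSign a b s s' t = 1) (c2 : triSign a b s s' t' = -1)
    (hcard : 5 ≤ ({s, s'} ∪ T : Finset V).card)
    (ih : ∀ W ⊂ {s, s'} ∪ T, minor a W = minor b W) :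
    minor a ({s, s'} ∪ T) = minor b ({s, s'} ∪ T) := by
  have ST : ∀ i ∈ ({s, s'} : Finset V), ∀ t ∈ T, i ≠ t := Finset.disjoint_iff_ne.1 hc.disj
  have Ts : ∀ t ∈ T, t ≠ s := fun t ht => (ST s (by simp) t ht).symm
  have Ts' : ∀ t ∈ T, t ≠ s' := fun t ht => (ST s' (by simp) t ht).symm
  have e : ∀ x ∈ T, normEntry a s s' x = normEntry a s s' t ∧
      normEntry a s x s' = normEntry a s t s' := by
    intro x hx
    have p := hc.par s (by simp) s' (by simp) x hx t ht
    exact ⟨(par_row_iff h.dense hss.symm (Ts x hx) (Ts t ht)).1 p.1,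
      (par_col_iff h.dense hss.symm (Ts x hx) (Ts t ht)).1 p.2⟩
  have nz : ∀ x ∈ T, triSign a b s s' x ≠ 0 := by
    intro x hx
    rw [Ne, (h.normEntry_or hss.symm (Ts x hx)).1, (e x hx).1, (e x hx).2,
      ← (h.normEntry_or hss.symm (Ts t ht)).1, c1]
    decide
  have pm : ∀ c : SignType, c ≠ 0 → c ≠ 1 → c = -1 := by decide
  set X := T.filter fun x => triSign a b s s' x = 1 with hX
  set Z := T.filter fun x => ¬ triSign a b s s' x = 1 with hZ
  have hXZ : Disjoint X Z := Finset.disjoint_filter_filter_not T T _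
  have hT : X ∪ Z = T := Finset.filter_union_filter_not_eq _ T
  have memX : ∀ x ∈ X, x ∈ T ∧ triSign a b s s' x = 1 := fun x hx => Finset.mem_filter.1 hx
  have memZ : ∀ x ∈ Z, x ∈ T ∧ triSign a b s s' x = -1 := fun x hx =>
    ⟨(Finset.mem_filter.1 hx).1, pm _ (nz x (Finset.mem_filter.1 hx).1) (Finset.mem_filter.1 hx).2⟩
  have tX : t ∈ X := Finset.mem_filter.2 ⟨ht, c1⟩
  have tZ : t' ∈ Z := Finset.mem_filter.2 ⟨ht', by rw [c2]; decide⟩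
  have f1 : ∀ x ∈ X, normEntry b s s' x = normEntry a s s' t ∧
      normEntry b s x s' = normEntry a s t s' := by
    intro x hx
    obtain ⟨hxT, hc1⟩ := memX x hx
    have hn : triSign a b s s' x ≠ -1 := by rw [hc1]; decide
    rw [(h.normEntry_or hss.symm (Ts x hxT)).2.1.1 hn,
      (h.normEntry_or (Ts x hxT) hss.symm).2.1.1 (by rwa [h.triSign_swap])]
    exact e x hxT
  have f2 : ∀ x ∈ Z, normEntry b s s' x = normEntry a s t s' ∧
      normEntry b s x s' = normEntry a s s' t := by
    intro x hx
    obtain ⟨hxT, hc1⟩ := memZ x hx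
    have hn : triSign a b s s' x ≠ 1 := by rw [hc1]; decide
    rw [(h.normEntry_or hss.symm (Ts x hxT)).2.2.1 hn,
      (h.normEntry_or (Ts x hxT) hss.symm).2.2.1 (by rwa [h.triSign_swap])]
    exact (e x hxT).symm
  have f3 : ∀ x ∈ X, ∀ z ∈ Z, normEntry b s x z = normEntry a s t s' ∧
      normEntry b s z x = normEntry a s s' t := by
    intro x hx z hz
    obtain ⟨hxT, hx1⟩ := memX x hx
    obtain ⟨hzT, hz1⟩ := memZ z hz
    have ex := e x hxT
    have ez := e z hzT
    have n1 := h.normEntry_or (Ts x hxT) (Ts z hzT)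
    have n2 := h.normEntry_or (Ts z hzT) (Ts x hxT)
    rw [h.triSign_swap] at n2
    rcases h.tri hss.symm (Ts x hxT) (Ts z hzT) hx1 hz1 with ⟨q, q1, q2⟩ | ⟨q, q1, q2⟩
    · have hn : triSign a b s x z ≠ -1 := by rw [q]; decide
      rw [n1.2.1.1 hn, n2.2.1.1 hn, ← q1, ← q2]
      exact ⟨ex.2, ex.1⟩
    · have hn : triSign a b s x z ≠ 1 := by rw [q]; decide
      rw [n1.2.2.1 hn, n2.2.2.1 hn, ← q1, ← q2]
      exact ⟨ez.2, ez.1⟩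
  have sT : s ∉ T := fun q => Ts s q rfl
  have s'T : s' ∉ T := fun q => Ts' s' q rfl
  have two : ∀ Y : Finset V, 2 ≤ Y.card → ∃ x ∈ Y, ∃ y ∈ Y, x ≠ y := by
    intro Y hY
    obtain ⟨x, hx, y, hy, hxy⟩ := Finset.one_lt_card.1 hY
    exact ⟨x, hx, y, hy, hxy⟩
  have hc5 : 5 ≤ 2 + (X.card + Z.card) := by
    have e1 := Finset.card_union_of_disjoint hc.disj
    have e2 := Finset.card_union_of_disjoint hXZ
    rw [hT] at e2
    rw [e1, e2, Finset.card_pair hss] at hcard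
    exact hcard
  by_cases hX2 : 2 ≤ X.card
  · exact h.minor_eq_of_twins hss sT s'T hXZ hT (two X hX2) ⟨t', tZ⟩ hc.par f1 f2 f3 ih
  · exact h.minor_eq_of_twins hss sT s'T hXZ.symm (by rw [Finset.union_comm, hT])
      (two Z (by omega)) ⟨t, tX⟩ hc.par f2 f1
      (fun z hz x hx => (f3 x hx z hz).symm) ih

/-- Smallness of `S` excludes cuts of `insert t S`, which is therefore coherent. If triangles `i j
k` with `i, j ∈ S` and `k ∈ T` have signs independent of `k`, then `b` shares the cut; otherwise `S`
is a pair. -/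
theorem MinorData.minor_eq (h : MinorData a b)
    (h4 : ∀ W : Finset V, W.card ≤ 4 → minor a W = minor b W) (W : Finset V) :
    minor a W = minor b W := by
  induction W using Finset.strongInduction with
  | H W ih =>
    by_cases hW : W.card ≤ 4
    · exact h4 W hW
    rcases h.coherent_or_hasCut W with hco | ⟨S₀, T₀, c0, c1, c2, c3, c4⟩
    · exact h.minor_eq_of_coherent hco
    obtain ⟨S, ⟨T, hc⟩, hmin⟩ := WellFounded.has_min (measure (Finset.card (α := V))).wf
      {S | ∃ T, IsCut a W S T} ⟨S₀, T₀, ⟨c0, c1, c2, c3, c4⟩⟩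
    have ST : ∀ s ∈ S, ∀ t ∈ T, s ≠ t := Finset.disjoint_iff_ne.1 hc.disj
    have hno : ∀ t ∈ T, ¬ HasCut a (insert t S) := by
      rintro t ht ⟨S₁, T₁, d0, d1, d2, d3, d4⟩
      have hc1 : IsCut a (insert t S) S₁ T₁ := ⟨d0, d1, d2, d3, d4⟩
      have ht1 : t ∈ S₁ ∪ T₁ := by rw [d1]; exact Finset.mem_insert_self _ _
      rcases Finset.mem_union.1 ht1 with q | q
      · have r := hc.refine h.dense ht hc1.symm q
        exact hmin T₁ ⟨_, r.2⟩ (Finset.card_lt_card r.1)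
      · have r := hc.refine h.dense ht hc1 q
        exact hmin S₁ ⟨_, r.2⟩ (Finset.card_lt_card r.1)
    have hcoh : ∀ t ∈ T, Coherent a b (insert t S) := fun t ht =>
      (h.coherent_or_hasCut _).resolve_right (hno t ht)
    by_cases hcom : ∀ i ∈ S, ∀ j ∈ S, ∀ k ∈ T, ∀ l ∈ T, triSign a b i j k = triSign a b i j l
    · have hcb : ∀ i ∈ S, ∀ j ∈ S, ∀ k ∈ T, ∀ l ∈ T, Par b i j k l ∧ Par b k l i j :=
        fun i hi j hj k hk l hl => h.par_of_triSign_eq (ST i hi k hk) (ST i hi l hl)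
          (hc.par i hi j hj k hk l hl).1 (hc.par i hi j hj k hk l hl).2 (hcom i hi j hj k hk l hl)
      obtain ⟨s, hs, s', hs', hss⟩ := hc.left
      obtain ⟨t, ht, t', ht', htt⟩ := hc.right
      have sub_of : ∀ U ⊆ W, ∀ v ∈ W, v ∉ U → U ⊂ W :=
        fun U h1 v h2 h3 => Finset.ssubset_iff_subset_ne.2 ⟨h1, fun e => h3 (e ▸ h2)⟩
      have SW : S ⊆ W := hc.union ▸ Finset.subset_union_left
      have TW : T ⊆ W := hc.union ▸ Finset.subset_union_right
      rw [← hc.union]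
      refine minor_eq_of_cut hc.disj hs ht (h.dense s t (ST s hs t ht))
        (h.dense t s (ST s hs t ht).symm) (h.two s t) (h.diag s) (h.diag t) hc.par hcb
        (ih S (sub_of S SW t (TW ht) fun q => ST t q t ht rfl))
        (ih T (sub_of T TW s (SW hs) fun q => ST s hs s q rfl))
        (ih _ (sub_of _ (Finset.union_subset SW (by simpa using TW ht)) t' (TW ht') ?_))
        (ih _ (sub_of _ (Finset.union_subset (by simpa using SW hs) TW) s' (SW hs') ?_))
      · simp only [Finset.mem_union, Finset.mem_singleton, not_or]
        exact ⟨fun q => ST t' q t' ht' rfl, htt.symm⟩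
      · simp only [Finset.mem_union, Finset.mem_singleton, not_or]
        exact ⟨hss.symm, fun q => ST s' hs' s' q rfl⟩
    · push Not at hcom
      obtain ⟨s₁, hs₁, s₂, hs₂, t₁, ht₁, t₂, ht₂, hne⟩ := hcom
      have s12 : s₂ ≠ s₁ := by
        rintro rfl
        apply hne
        rw [← triSign_rotate, ← triSign_rotate, triSign_self, ← triSign_rotate a b s₂ s₂ t₂,
          ← triSign_rotate, triSign_self]
      -- Whether the triangle is symmetric depends only on `a`, whose normalised entries towards `T`
      -- are constant; so the differing signs are `1` and `-1`.
      have hz : triSign a b s₁ s₂ t₁ = 0 ↔ triSign a b s₁ s₂ t₂ = 0 := by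
        have p := hc.par s₁ hs₁ s₂ hs₂ t₁ ht₁ t₂ ht₂
        have n1 := (ST s₁ hs₁ t₁ ht₁).symm
        have n2 := (ST s₁ hs₁ t₂ ht₂).symm
        rw [(h.normEntry_or s12 n1).1, (h.normEntry_or s12 n2).1,
          (par_row_iff h.dense s12 n1 n2).1 p.1, (par_col_iff h.dense s12 n1 n2).1 p.2]
      have key : ∀ c d : SignType, (c = 0 ↔ d = 0) → c ≠ d →
          (c = 1 ∧ d = -1) ∨ (d = 1 ∧ c = -1) := by decide
      obtain ⟨t, ht, t', ht', k1, k2⟩ : ∃ t ∈ T, ∃ t' ∈ T, triSign a b s₁ s₂ t = 1 ∧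
          triSign a b s₁ s₂ t' = -1 := by
        rcases key _ _ hz hne with q | q
        · exact ⟨t₁, ht₁, t₂, ht₂, q⟩
        · exact ⟨t₂, ht₂, t₁, ht₁, q⟩
      have hS := h.eq_pair_of_minimal hc (hcoh t ht) (hno t ht) hs₁ hs₂ ht ht' k1 k2
      subst hS
      have hU := hc.union
      subst hU
      exact h.minor_eq_of_pair_cut hc s12.symm ht ht' k1 k2 (by omega) ih

end Final

/-! ### From ranks of submatrices and minors of order at most four to `MinorData`. -/

section Rank

variable {F : Type*} [Field F] {n : ℕ}

theorem par_of_rank_sub {A : Matrix (Fin n) (Fin n) F} {S T : Finset (Fin n)}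
    (h : (sub A S T).rank = 1) {i j k l : Fin n} (hi : i ∈ S) (hj : j ∈ S) (hk : k ∈ T)
    (hl : l ∈ T) : Par A i j k l := by
  by_contra hne
  let M : Matrix (Fin 2) (Fin 2) F :=
    (sub A S T).submatrix ![⟨i, hi⟩, ⟨j, hj⟩] ![⟨k, hk⟩, ⟨l, hl⟩]
  have hdet : M.det ≠ 0 := by
    rw [Matrix.det_fin_two]
    simp only [M, sub, Matrix.submatrix_apply, Matrix.cons_val_zero, Matrix.cons_val_one]
    exact sub_ne_zero.2 hne
  have h2 := Matrix.rank_of_det_ne_zero (A := M) hdet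
  have h3 := (sub A S T).rank_submatrix_le ![⟨i, hi⟩, ⟨j, hj⟩] ![⟨k, hk⟩, ⟨l, hl⟩]
  have h4 : M.rank ≤ 1 := h ▸ h3
  rw [h2] at h4
  simp at h4

theorem rank_sub_pair {A : Matrix (Fin n) (Fin n) F} {i j k l : Fin n} (hik : A i k ≠ 0)
    (h : Par A i j k l) : (sub A {i, j} {k, l}).rank = 1 := by
  have hM : sub A {i, j} {k, l} = Matrix.vecMulVec
      (fun r : ({i, j} : Finset (Fin n)) => A r k / A i k)
      (fun c : ({k, l} : Finset (Fin n)) => A i c) := by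
    ext ⟨r, hr⟩ ⟨c, hc⟩
    simp only [Finset.mem_insert, Finset.mem_singleton] at hr hc
    simp only [sub, Matrix.submatrix_apply, Matrix.vecMulVec_apply]
    replace h : A i k * A j l = A i l * A j k := h
    rcases hr with rfl | rfl <;> rcases hc with rfl | rfl <;> field_simp
    linear_combination h
  apply le_antisymm
  · rw [hM]; exact Matrix.rank_vecMulVec_le _ _
  · let M : Matrix (Fin 1) (Fin 1) F :=
      (sub A {i, j} {k, l}).submatrix (fun _ => ⟨i, by simp⟩) (fun _ => ⟨k, by simp⟩)
    have hdet : M.det ≠ 0 := by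
      rw [Matrix.det_fin_one]; exact hik
    have h2 := Matrix.rank_of_det_ne_zero (A := M) hdet
    have h3 : M.rank ≤ (sub A {i, j} {k, l}).rank := Matrix.rank_submatrix_le _ _ _
    rw [h2] at h3
    simpa using h3

theorem minorData_of_propertyR {A B : Matrix (Fin n) (Fin n) F} (hA : PropertyR A)
    (hAB : PMEUpTo 4 A B) : MinorData A B := by
  have h4 : ∀ W : Finset (Fin n), W.card ≤ 4 → minor A W = minor B W := hAB
  have diag : ∀ i, A i i = B i i := by
    intro i
    have := h4 {i} (by simp)
    rwa [minor_singleton A, minor_singleton B] at this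
  have two : ∀ i j, A i j * A j i = B i j * B j i := by
    intro i j
    by_cases hij : i = j
    · subst hij; rw [diag]
    have := h4 {i, j} (Finset.card_le_two.trans (by norm_num))
    rw [minor_pair A hij, minor_pair B hij, diag, diag] at this
    linear_combination -this
  have three : ∀ i j k, cyc A i j k + cyc A i k j = cyc B i j k + cyc B i k j := by
    intro i j k
    by_cases hij : i = j
    · subst hij
      simp only [cyc]
      rw [diag]
      linear_combination 2 * B i i * two i k
    by_cases hik : i = k
    · subst hik
      simp only [cyc]
      rw [diag]
      linear_combination 2 * B i i * two i j
    by_cases hjk : j = k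
    · subst hjk
      simp only [cyc]
      rw [diag]
      linear_combination 2 * B j j * two i j
    have := h4 {i, j, k} (Finset.card_le_three.trans (by norm_num))
    rw [minor_triple A hij hik hjk, minor_triple B hij hik hjk, diag, diag, diag, two i j, two i k,
      two j k] at this
    linear_combination this
  refine ⟨hA.1, ?_, diag, two, three, ?_⟩
  · intro i j k l m hij hkl hik hil hjk hjl mi mj mk ml h
    obtain ⟨S, iS, jS, kS, lS, hr⟩ := hA.2 i j k l hij hik hil hjk hjl hkl
      (rank_sub_pair (hA.1 i k hik) h)
    -- The fifth index lies on one side of the extended rank-one block, hence joins its rows or its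
    -- columns.
    by_cases hm : m ∈ S
    · exact Or.inl (par_of_rank_sub hr iS hm kS lS)
    · exact Or.inr (par_of_rank_sub hr iS jS kS (Finset.mem_compl.2 hm))
  · intro i j k l hij hik hil hjk hjl hkl
    have := h4 {i, j, k, l} Finset.card_le_four
    rw [minor_quadruple A hij hik hil hjk hjl hkl, minor_quadruple B hij hik hil hjk hjl hkl, diag,
      diag, diag, diag, two i j, two i k, two i l, two j k, two j l, two k l, three, three, three,
      three] at this
    linear_combination -this

end Rank

end PrincipalMinors

theorem theorem1p3 {F : Type*} [Field F] {n : ℕ} (A B : Matrix (Fin n) (Fin n) F)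
    (hA : PrincipalMinors.PropertyR A) (hAB : PrincipalMinors.PMEUpTo 4 A B) :
    PrincipalMinors.PME A B :=
  (PrincipalMinors.minorData_of_propertyR hA hAB).minor_eq hAB
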